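/- Let $L$ be an algebraically closed field (of any characteristic). Put $K_0=L$, let $K_{i+1}=K_i((t_{i+1}))^{alg}$ be an algebraic closure of the field of formal Laurent series over $K_i$, and let $K_\omega=\bigcup_i K_i$. The $t_{i+1}$-adic absolute value of $K_i((t_{i+1}))$ extends uniquely to $K_{i+1}$, with residue field $K_i$. Scaling homogeneous coordinates so that all of them lie in the valuation ring and at least one is a unit, and then taking residues, defines maps $\pi_{i+1}:\mathbb P^n(K_{i+1})\to\mathbb P^n(K_i)$. Let $\Pi_\omega:\mathbb P^n(K_\omega)\to\mathbb P^n(L)$ be the map whose restriction to $\mathbb P^n(K_N)$ is $\pi_1\circ\cdots\circ\pi_N$ for every $N$. Let $V\subset\mathbb P^n(L)$ be a smooth projective variety over $L$. For a point $a\in V(L)^r$, the infinitesimal neighbourhood $\mathcal V_a$ is the set of points of $V(K_\omega)^r$ that $\Pi_\omega$, applied in each of the $r$ factors, maps to $a$. Theorem. Let $D\subset V^m$ be a smooth closed subvariety defined over $L$, and let $F\subset D\times V^k$ be an irreducible closed subvariety defined over $L$ which is a finite cover of $D$, i.e. the projection $F\to D$ is surjective with finite fibres. Let $(a,b)\in F(L)$.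 If $a'\in\mathcal V_a\cap D(K_\omega)$ is generic in $D$ over $L$ (the intersection of all closed subvarieties defined over $L$ that contain $a'$ is $D$), then there is $b'\in\mathcal V_b$ such that $(a',b')\in F(K_\omega)$. -/

import Mathlib

universe u

namespace ZariskiSpec

open scoped WithZero

/-! ### The valued field `K((t))^alg` -/

section Valuation

variable (K : Type u) [Field K]

theorem laurent_isRankOneDiscrete :
    (Valued.v : Valuation (LaurentSeries K) ℤᵐ⁰).IsRankOneDiscrete := by
  have : Nontrivial (MonoidWithZeroHom.valueGroup
      (.ofClass (Valued.v : Valuation (LaurentSeries K) ℤᵐ⁰))) := by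
    obtain ⟨x, hx⟩ := LaurentSeries.valuation_surjective K (WithZero.exp (1 : ℤ))
    rw [Subgroup.nontrivial_iff_exists_ne_one]
    refine ⟨Units.mk0 (WithZero.exp (1 : ℤ)) WithZero.exp_ne_zero,
      Subgroup.subset_closure ⟨x, hx⟩, ?_⟩
    intro h
    have h2 := congrArg Units.val h
    simp at h2
  exact Valuation.IsRankOneDiscrete.mk' _

/-- The `t`-adic absolute value on `K((t))`, normalised so that `|t| = 1/2`. It induces the usual
topology, for which `K((t))` is complete. -/
@[reducible]
noncomputable def laurentNormedField : NontriviallyNormedField (LaurentSeries K) :=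
  haveI := laurent_isRankOneDiscrete K
  letI : (Valued.v : Valuation (LaurentSeries K) ℤᵐ⁰).RankOne :=
    Valuation.IsRankOneDiscrete.rankOne _ (one_lt_two (α := NNReal))
  Valued.toNontriviallyNormedField (LaurentSeries K) ℤᵐ⁰

theorem laurent_isUltrametric :
    @IsUltrametricDist (LaurentSeries K) (laurentNormedField K).toDist := by
  have := laurent_isRankOneDiscrete K
  let : (Valued.v : Valuation (LaurentSeries K) ℤᵐ⁰).RankOne :=
    Valuation.IsRankOneDiscrete.rankOne _ (one_lt_two (α := NNReal))
  exact Valued.instIsUltrametricDist _ _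

theorem laurent_complete :
    @CompleteSpace (LaurentSeries K) (laurentNormedField K).toUniformSpace :=
  LaurentSeries.instLaurentSeriesComplete

theorem laurent_norm_le_one (f : LaurentSeries K) :
    @norm _ (laurentNormedField K).toNorm f ≤ 1 ↔ Valued.v f ≤ (1 : ℤᵐ⁰) := by
  have := laurent_isRankOneDiscrete K
  let : (Valued.v : Valuation (LaurentSeries K) ℤᵐ⁰).RankOne :=
    Valuation.IsRankOneDiscrete.rankOne _ (one_lt_two (α := NNReal))
  exact Valued.toNormedField.norm_le_one_iff

theorem laurent_norm_lt_one (f : LaurentSeries K) :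
    @norm _ (laurentNormedField K).toNorm f < 1 ↔ Valued.v f < (1 : ℤᵐ⁰) := by
  have := laurent_isRankOneDiscrete K
  let : (Valued.v : Valuation (LaurentSeries K) ℤᵐ⁰).RankOne :=
    Valuation.IsRankOneDiscrete.rankOne _ (one_lt_two (α := NNReal))
  exact Valued.toNormedField.norm_lt_one_iff

/-- The field `K((t))^alg`. -/
abbrev LaurentAlg : Type u := AlgebraicClosure (LaurentSeries K)

/-- The embedding of `K` into `K((t))^alg` as the constants. -/
noncomputable def constHom : K →+* LaurentAlg K :=
  (algebraMap (LaurentSeries K) (LaurentAlg K)).comp HahnSeries.C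

/-- `K((t))^alg` with the spectral absolute value, the unique extension of the `t`-adic absolute
value of `K((t))`. -/
@[reducible]
noncomputable def laurentAlgNormedField : NormedField (LaurentAlg K) :=
  letI := laurentNormedField K
  haveI := laurent_isUltrametric K
  haveI := laurent_complete K
  spectralNorm.normedField (LaurentSeries K) (LaurentAlg K)

/-- The spectral absolute value of an element of `K((t))^alg`. -/
noncomputable def extNorm (x : LaurentAlg K) : ℝ :=
  letI := laurentNormedField K
  spectralNorm (LaurentSeries K) (LaurentAlg K) x

variable {K}

theorem extNorm_mul (x y : LaurentAlg K) : extNorm K (x * y) = extNorm K x * extNorm K y :=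
  letI := laurentAlgNormedField K
  norm_mul x y

theorem extNorm_nonneg (x : LaurentAlg K) : 0 ≤ extNorm K x :=
  letI := laurentAlgNormedField K
  norm_nonneg x

theorem extNorm_eq_zero {x : LaurentAlg K} : extNorm K x = 0 ↔ x = 0 :=
  letI := laurentAlgNormedField K
  norm_eq_zero (a := x)

theorem extNorm_zero : extNorm K (0 : LaurentAlg K) = 0 := extNorm_eq_zero.2 rfl

theorem extNorm_one : extNorm K (1 : LaurentAlg K) = 1 :=
  letI := laurentAlgNormedField K
  norm_one (α := LaurentAlg K)

theorem extNorm_sub_comm (x y : LaurentAlg K) : extNorm K (x - y) = extNorm K (y - x) :=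
  letI := laurentAlgNormedField K
  norm_sub_rev x y

theorem extNorm_add_le (x y : LaurentAlg K) :
    extNorm K (x + y) ≤ max (extNorm K x) (extNorm K y) := by
  let := laurentNormedField K
  have := laurent_isUltrametric K
  exact isNonarchimedean_spectralNorm x y

theorem extNorm_algebraMap (f : LaurentSeries K) :
    extNorm K (algebraMap _ _ f) = @norm _ (laurentNormedField K).toNorm f := by
  let := laurentNormedField K
  have := laurent_isUltrametric K
  exact spectralNorm_extends f

theorem extNorm_const_le (c : K) : extNorm K (constHom K c) ≤ 1 := by
  rw [constHom, RingHom.comp_apply, extNorm_algebraMap, laurent_norm_le_one,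
    LaurentSeries.val_le_one_iff_eq_coe]
  exact ⟨PowerSeries.C c, PowerSeries.coe_C c⟩

theorem extNorm_const {c : K} (hc : c ≠ 0) : extNorm K (constHom K c) = 1 := by
  refine le_antisymm (extNorm_const_le c) ?_
  have h : extNorm K (constHom K c) * extNorm K (constHom K c⁻¹) = 1 := by
    rw [← extNorm_mul, ← map_mul, mul_inv_cancel₀ hc, map_one, extNorm_one]
  nlinarith [extNorm_const_le c⁻¹, extNorm_nonneg (constHom K c)]

theorem eq_of_extNorm_const_sub_lt {c d : K} (h : extNorm K (constHom K c - constHom K d) < 1) :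
    c = d := by
  by_contra hcd
  rw [← map_sub, extNorm_const (sub_ne_zero.2 hcd)] at h
  exact lt_irrefl _ h

theorem extNorm_sum_lt {ι : Type*} (s : Finset ι) (f : ι → LaurentAlg K)
    (h : ∀ i ∈ s, extNorm K (f i) < 1) : extNorm K (∑ i ∈ s, f i) < 1 := by
  classical
  induction s using Finset.induction_on with
  | empty => simp [extNorm_zero]
  | insert a s ha ih =>
    rw [Finset.sum_insert ha]
    exact (extNorm_add_le _ _).trans_lt (max_lt (h a (Finset.mem_insert_self a s))
      (ih fun i hi => h i (Finset.mem_insert_of_mem hi)))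

/-- The residue field of `K((t))^alg` is `K` when `K` is algebraically closed. -/
theorem exists_residue [IsAlgClosed K] (x : LaurentAlg K) (hx : extNorm K x ≤ 1) :
    ∃ c : K, extNorm K (x - constHom K c) < 1 := by
  let := laurentNormedField K
  have := laurent_isUltrametric K
  have hint : IsIntegral (LaurentSeries K) x := Algebra.IsIntegral.isIntegral x
  set p := minpoly (LaurentSeries K) x with hp
  have hmon : p.Monic := minpoly.monic hint
  have hcoef : ∀ n, ∃ c : K, extNorm K (algebraMap _ _ (p.coeff n) - constHom K c) < 1 := by
    intro n
    have h1 : ‖p.coeff n‖ ≤ 1 := (spectralValue_le_one_iff hmon).1 hx n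
    rw [laurent_norm_le_one] at h1
    have h1' := (LaurentSeries.valuation_le_iff_coeff_lt_eq_zero K (D := 0)).1 (by simpa using h1)
    refine ⟨(p.coeff n).coeff 0, ?_⟩
    rw [constHom, RingHom.comp_apply, ← map_sub, extNorm_algebraMap, laurent_norm_lt_one]
    refine lt_of_le_of_lt ((LaurentSeries.valuation_le_iff_coeff_lt_eq_zero K (D := 1)).2 ?_)
      (WithZero.exp_lt_exp.2 (by norm_num : (-1 : ℤ) < 0))
    intro m hm
    rcases lt_or_eq_of_le (Int.lt_add_one_iff.1 (by simpa using hm : m < 0 + 1)) with h | h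
    · rw [HahnSeries.coeff_sub, h1' m h, HahnSeries.C_apply, HahnSeries.coeff_single_of_ne h.ne,
        sub_zero]
    · subst h
      simp
  choose c hc using hcoef
  set d := p.natDegree with hd
  let r : Polynomial K := ∑ n ∈ Finset.range d, Polynomial.C (c n) * Polynomial.X ^ n
  have hlt : r.degree < d := by
    simp only [r, Finset.sum_range]
    exact Polynomial.degree_sum_fin_lt fun i : Fin d => c i
  let q : Polynomial K := Polynomial.X ^ d + r
  have hqm : q.Monic := Polynomial.monic_X_pow_add hlt
  have hq : extNorm K ((q.map (constHom K)).eval x) < 1 := by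
    have h0 : Polynomial.eval₂ (algebraMap (LaurentSeries K) (LaurentAlg K)) x p = 0 :=
      minpoly.aeval _ _
    rw [hmon.as_sum, Polynomial.eval₂_add, Polynomial.eval₂_finsetSum] at h0
    simp only [Polynomial.eval₂_mul, Polynomial.eval₂_C, Polynomial.eval₂_X_pow] at h0
    have h1 : (q.map (constHom K)).eval x = -∑ n ∈ Finset.range d,
        (algebraMap (LaurentSeries K) (LaurentAlg K) (p.coeff n) - constHom K (c n)) * x ^ n := by
      simp only [sub_mul, Finset.sum_sub_distrib]
      rw [← sub_eq_zero, ← h0]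
      simp [q, r, Polynomial.eval_finsetSum, Polynomial.map_sum]
      rw [← hd]
      ring
    rw [h1, ← zero_sub, extNorm_sub_comm, sub_zero]
    refine extNorm_sum_lt _ _ fun n _ => ?_
    rw [extNorm_mul]
    refine mul_lt_one_of_nonneg_of_lt_one_left (extNorm_nonneg _) (hc n) ?_
    clear * - hx
    induction n with
    | zero => simp [extNorm_one]
    | succ n ih =>
      rw [pow_succ, extNorm_mul]
      exact mul_le_one₀ ih (extNorm_nonneg _) hx
  have hsplit := IsAlgClosed.splits q
  rw [hsplit.eq_prod_roots_of_monic hqm, Polynomial.map_multiset_prod, Multiset.map_map] at hq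
  by_contra! hcon
  refine absurd hq (not_lt.2 ?_)
  clear hq
  induction q.roots using Multiset.induction_on with
  | empty => simp [extNorm_one]
  | cons a s ih =>
    rw [Multiset.map_cons, Multiset.prod_cons, Polynomial.eval_mul, extNorm_mul]
    have e : Polynomial.eval x ((Polynomial.map (constHom K) ∘
        fun a => Polynomial.X - Polynomial.C a) a) = x - constHom K a := by simp
    rw [e]
    exact one_le_mul_of_one_le_of_one_le (hcon a) ih

end Valuation
/-! ### Projective space and the reduction maps -/

section Reduction

/-- The set of `K`-points of the projective space `ℙⁿ`. -/
abbrev PSpace (K : Type u) [Field K] (n : ℕ) : Type u := Projectivization K (Fin (n + 1) → K)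

theorem comp_ne_zero {K K' : Type u} [Field K] [Field K'] (σ : K →+* K') {n : ℕ}
    {v : Fin (n + 1) → K} (hv : v ≠ 0) : (fun j => σ (v j)) ≠ 0 := fun h =>
  hv (funext fun j => (map_eq_zero_iff σ σ.injective).1 (congrFun h j))

/-- The map `ℙⁿ(K) → ℙⁿ(K')` induced by an embedding of fields `K → K'`. -/
noncomputable def PSpace.ext {K K' : Type u} [Field K] [Field K'] (σ : K →+* K') {n : ℕ} :
    PSpace K n → PSpace K' n :=
  Projectivization.map (σ := σ)
    { toFun := fun v j => σ (v j)
      map_add' := fun v w => funext fun j => map_add σ (v j) (w j)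
      map_smul' := fun c v => funext fun j => map_mul σ c (v j) }
    (fun _ _ h => funext fun j => σ.injective (congrFun h j))

theorem PSpace.ext_mk {K K' : Type u} [Field K] [Field K'] (σ : K →+* K') {n : ℕ}
    (v : Fin (n + 1) → K) (hv : v ≠ 0) :
    PSpace.ext σ (Projectivization.mk K v hv) =
      Projectivization.mk K' (fun j => σ (v j)) (comp_ne_zero σ hv) :=
  rfl

variable {K : Type u} [Field K] {n : ℕ}

/-- `Reduces p q`: after scaling the homogeneous coordinates `f` of the point `p` over `K((t))^alg`
so that all of them lie in the valuation ring and at least one is a unit, their residues are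
homogeneous coordinates `g` of the point `q` over `K`. (As `g ≠ 0`, the condition that `g j` be the
residue of `f j` for all `j` forces such a scaling.) -/
def Reduces (p : PSpace (LaurentAlg K) n) (q : PSpace K n) : Prop :=
  ∃ (f : Fin (n + 1) → LaurentAlg K) (hf : f ≠ 0) (g : Fin (n + 1) → K) (hg : g ≠ 0),
    p = Projectivization.mk _ f hf ∧ q = Projectivization.mk _ g hg ∧
      ∀ j, extNorm K (f j - constHom K (g j)) < 1

theorem extNorm_le_one_of_sub_lt {x : LaurentAlg K} {c : K}
    (h : extNorm K (x - constHom K c) < 1) : extNorm K x ≤ 1 := by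
  have := extNorm_add_le (x - constHom K c) (constHom K c)
  rw [sub_add_cancel] at this
  exact this.trans (max_le h.le (extNorm_const_le c))

theorem extNorm_eq_one_of_sub_lt {x : LaurentAlg K} {c : K} (hc : c ≠ 0)
    (h : extNorm K (x - constHom K c) < 1) : extNorm K x = 1 := by
  refine le_antisymm (extNorm_le_one_of_sub_lt h) ?_
  by_contra! hx
  have := extNorm_add_le (constHom K c - x) x
  rw [sub_add_cancel, extNorm_const hc, extNorm_sub_comm] at this
  exact absurd this (not_le.2 (max_lt h hx))

variable [IsAlgClosed K]

theorem exists_reduces (p : PSpace (LaurentAlg K) n) : ∃ q : PSpace K n, Reduces p q := by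
  induction p using Projectivization.ind with
  | h v hv =>
    obtain ⟨i, -, hi⟩ := Finset.exists_max_image Finset.univ (fun j => extNorm K (v j))
      ⟨0, Finset.mem_univ _⟩
    have hvi : v i ≠ 0 := by
      intro h0
      refine hv (funext fun j => extNorm_eq_zero.1 (le_antisymm ?_ (extNorm_nonneg _)))
      have := hi j (Finset.mem_univ j)
      rwa [h0, extNorm_zero] at this
    have hpos : 0 < extNorm K (v i) :=
      lt_of_le_of_ne (extNorm_nonneg _) fun h => hvi (extNorm_eq_zero.1 h.symm)
    have hle : ∀ j, extNorm K ((v i)⁻¹ * v j) ≤ 1 := by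
      intro j
      have h1 : extNorm K (v i) * extNorm K ((v i)⁻¹ * v j) = extNorm K (v j) := by
        rw [← extNorm_mul, mul_inv_cancel_left₀ hvi]
      have h2 := hi j (Finset.mem_univ j)
      rw [← h1] at h2
      exact le_of_mul_le_mul_left (by simpa using h2) hpos
    choose g hg using fun j => exists_residue _ (hle j)
    have hf : (fun j => (v i)⁻¹ * v j) ≠ 0 := fun h => by
      have := congrFun h i
      simp [hvi] at this
    have hg0 : g ≠ 0 := fun h => by
      have := hg i
      rw [h] at this
      simp [hvi, extNorm_one] at this
    refine ⟨Projectivization.mk _ g hg0, _, hf, g, hg0, ?_, rfl, hg⟩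
    rw [Projectivization.mk_eq_mk_iff']
    exact ⟨v i, funext fun j => by simp [hvi]⟩

theorem Reduces.unique {p : PSpace (LaurentAlg K) n} {q q' : PSpace K n} (h : Reduces p q)
    (h' : Reduces p q') : q = q' := by
  obtain ⟨f, hf, g, hg, rfl, rfl, hfg⟩ := h
  obtain ⟨f', hf', g', hg', hff', rfl, hfg'⟩ := h'
  rw [Projectivization.mk_eq_mk_iff'] at hff'
  obtain ⟨s, rfl⟩ := hff'
  obtain ⟨i, hi⟩ := Function.ne_iff.1 hg'
  obtain ⟨l, hl⟩ := Function.ne_iff.1 hg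
  have hfi : extNorm K (f' i) = 1 := extNorm_eq_one_of_sub_lt hi (hfg' i)
  have hs : extNorm K s ≤ 1 := by
    have h1 := extNorm_le_one_of_sub_lt (hfg i)
    simpa [extNorm_mul, hfi] using h1
  obtain ⟨c, hc⟩ := exists_residue s hs
  have key : ∀ j, g j = c * g' j := by
    intro j
    apply eq_of_extNorm_const_sub_lt
    have e : constHom K (g j) - constHom K (c * g' j) = (constHom K (g j) - s * f' j) +
        ((s - constHom K c) * f' j + constHom K c * (f' j - constHom K (g' j))) := by
      rw [map_mul]; ring
    rw [e]
    refine (extNorm_add_le _ _).trans_lt (max_lt ?_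
      ((extNorm_add_le _ _).trans_lt (max_lt ?_ ?_)))
    · rw [extNorm_sub_comm]
      exact hfg j
    · rw [extNorm_mul]
      exact mul_lt_one_of_nonneg_of_lt_one_left (extNorm_nonneg _) hc
        (extNorm_le_one_of_sub_lt (hfg' j))
    · rw [extNorm_mul]
      exact mul_lt_one_of_nonneg_of_lt_one_right (extNorm_const_le c) (extNorm_nonneg _) (hfg' j)
  rw [Projectivization.mk_eq_mk_iff']
  exact ⟨c, funext fun j => (key j).symm⟩

/-- The reduction map `π : ℙⁿ(K((t))^alg) → ℙⁿ(K)`. -/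
noncomputable def reduction (p : PSpace (LaurentAlg K) n) : PSpace K n :=
  (exists_reduces p).choose

theorem reduces_reduction (p : PSpace (LaurentAlg K) n) : Reduces p (reduction p) :=
  (exists_reduces p).choose_spec

theorem reduction_eq_iff {p : PSpace (LaurentAlg K) n} {q : PSpace K n} :
    reduction p = q ↔ Reduces p q :=
  ⟨fun h => h ▸ reduces_reduction p, fun h => (reduces_reduction p).unique h⟩

theorem reduction_ext (q : PSpace K n) : reduction (PSpace.ext (constHom K) q) = q := by
  rw [reduction_eq_iff]
  induction q using Projectivization.ind with
  | h v hv =>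
    refine ⟨fun j => constHom K (v j), fun h => hv (funext fun j => ?_), v, hv, rfl, rfl, ?_⟩
    · exact (map_eq_zero_iff _ (constHom K).injective).1 (congrFun h j)
    · intro j
      rw [sub_self, extNorm_zero]
      exact one_pos

end Reduction

/-! ### The tower `L = K₀ ⊂ K₁ ⊂ ⋯` and its union `K_ω` -/

section Tower

/-- An algebraically closed field. -/
structure AlgClosedField where
  carrier : Type u
  [field : Field carrier]
  [isAlgClosed : IsAlgClosed carrier]

attribute [instance] AlgClosedField.field AlgClosedField.isAlgClosed

variable (L : Type u) [Field L] [IsAlgClosed L]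

/-- `K₀ = L` and `K_{i+1} = K_i((t_{i+1}))^alg`. -/
noncomputable def tower : ℕ → AlgClosedField.{u}
  | 0 => { carrier := L }
  | i + 1 => { carrier := LaurentAlg (tower i).carrier }

/-- The field `K_i` of the tower. -/
abbrev TowerField (i : ℕ) : Type u := (tower L i).carrier

/-- The inclusion `K_i ⊂ K_{i+1}`. -/
noncomputable def towerStep (i : ℕ) : TowerField L i →+* TowerField L (i + 1) :=
  constHom (TowerField L i)

/-- The inclusion `K_i ⊂ K_j` for `i ≤ j`. -/
noncomputable def towerMap (i j : ℕ) (h : i ≤ j) : TowerField L i →+* TowerField L j :=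
  Nat.leRecOn h (fun {k} g => (towerStep L k).comp g) (RingHom.id _)

theorem towerMap_self (i : ℕ) : towerMap L i i le_rfl = RingHom.id _ := Nat.leRecOn_self _

theorem towerMap_succ {i j : ℕ} (h : i ≤ j) :
    towerMap L i (j + 1) (h.trans j.le_succ) = (towerStep L j).comp (towerMap L i j h) :=
  Nat.leRecOn_succ h _

theorem towerMap_trans {i j k : ℕ} (hij : i ≤ j) (hjk : j ≤ k) (x : TowerField L i) :
    towerMap L j k hjk (towerMap L i j hij x) = towerMap L i k (hij.trans hjk) x := by
  induction k, hjk using Nat.le_induction with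
  | base => rw [towerMap_self]; rfl
  | succ k hjk ih =>
    rw [towerMap_succ L hjk, towerMap_succ L (hij.trans hjk), RingHom.comp_apply,
      RingHom.comp_apply, ih]

instance towerDirected : DirectedSystem (TowerField L) fun i j h => towerMap L i j h where
  map_self i x := by rw [towerMap_self]; rfl
  map_map _ _ _ hij hjk x := towerMap_trans L hij hjk x

/-- The field `K_ω = ⋃ K_i`. -/
abbrev KOmega : Type u := DirectLimit (TowerField L) (towerMap L)

/-- The inclusion `K_i ⊂ K_ω`. -/
noncomputable def toKOmega (i : ℕ) : TowerField L i →+* KOmega L :=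
  DirectLimit.Ring.of (TowerField L) (towerMap L) i

noncomputable instance : Algebra L (KOmega L) := (toKOmega L 0).toAlgebra

variable {L} {n : ℕ}

/-- The map `Π_{N,0} : ℙⁿ(K_N) → ℙⁿ(L)`, the composite of the reduction maps
`ℙⁿ(K_{i+1}) → ℙⁿ(K_i)` for `i < N`. -/
noncomputable def specTower : (N : ℕ) → PSpace (TowerField L N) n → PSpace L n
  | 0 => id
  | N + 1 => fun p => specTower N (reduction (K := TowerField L N) p)

theorem toKOmega_towerMap {i j : ℕ} (h : i ≤ j) (x : TowerField L i) :
    toKOmega L j (towerMap L i j h x) = toKOmega L i x :=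
  DirectLimit.Ring.of_f h x

theorem exists_tower_point (p : PSpace (KOmega L) n) :
    ∃ (N : ℕ) (q : PSpace (TowerField L N) n), PSpace.ext (toKOmega L N) q = p := by
  induction p using Projectivization.ind with
  | h v hv =>
    have hv' : ∀ j, ∃ (i : ℕ) (x : TowerField L i), v j = toKOmega L i x := fun j =>
      DirectLimit.exists_eq_mk (towerMap L) (v j)
    choose i x hx using hv'
    let N := Finset.univ.sup i
    have hN : ∀ j, i j ≤ N := fun j => Finset.le_sup (Finset.mem_univ j)
    let w : Fin (n + 1) → TowerField L N := fun j => towerMap L (i j) N (hN j) (x j)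
    have hw : ∀ j, toKOmega L N (w j) = v j := fun j => by
      rw [hx j]
      exact toKOmega_towerMap (hN j) (x j)
    have hw0 : w ≠ 0 := fun h => hv (funext fun j => by
      rw [← hw j, h]
      exact map_zero _)
    refine ⟨N, Projectivization.mk _ w hw0, ?_⟩
    rw [PSpace.ext_mk]
    simp only [hw]

/-- The specialisation map `Π_ω : ℙⁿ(K_ω) → ℙⁿ(L)`, the union of the maps `Π_{N,0}`. -/
noncomputable def specialisation (p : PSpace (KOmega L) n) : PSpace L n :=
  specTower (exists_tower_point p).choose (exists_tower_point p).choose_spec.choose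

theorem PSpace.ext_ext {K K' K'' : Type u} [Field K] [Field K'] [Field K''] {σ : K →+* K'}
    {τ : K' →+* K''} {ρ : K →+* K''} (h : ∀ x, τ (σ x) = ρ x) (p : PSpace K n) :
    PSpace.ext τ (PSpace.ext σ p) = PSpace.ext ρ p := by
  induction p using Projectivization.ind with
  | h v hv =>
    simp only [PSpace.ext_mk]
    simp only [h]

theorem PSpace.ext_id {K : Type u} [Field K] (p : PSpace K n) :
    PSpace.ext (RingHom.id K) p = p := by
  induction p using Projectivization.ind with
  | h v hv => rfl

theorem PSpace.ext_injective {K K' : Type u} [Field K] [Field K'] (σ : K →+* K') :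
    Function.Injective (PSpace.ext σ (n := n)) := by
  intro p q h
  induction p using Projectivization.ind with
  | h v hv =>
    induction q using Projectivization.ind with
    | h w hw =>
      simp only [PSpace.ext_mk] at h
      rw [Projectivization.mk_eq_mk_iff'] at h ⊢
      obtain ⟨a, ha⟩ := h
      have ha' : ∀ j, a * σ (w j) = σ (v j) := fun j => congrFun ha j
      obtain ⟨i, hi⟩ := Function.ne_iff.1 hw
      have hi : w i ≠ 0 := hi
      have hσ : σ (w i) ≠ 0 := (map_ne_zero σ).2 hi
      have hae : a = σ (v i / w i) := by
        rw [map_div₀, ← ha' i, mul_div_cancel_right₀ _ hσ]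
      refine ⟨v i / w i, funext fun j => σ.injective ?_⟩
      have := ha' j
      rw [hae, ← map_mul] at this
      exact this

theorem specTower_towerMap {N M : ℕ} (h : N ≤ M) (q : PSpace (TowerField L N) n) :
    specTower M (PSpace.ext (towerMap L N M h) q) = specTower N q := by
  induction M, h using Nat.le_induction with
  | base => rw [towerMap_self, PSpace.ext_id]
  | succ M h ih =>
    rw [towerMap_succ L h, ← PSpace.ext_ext (σ := towerMap L N M h) (τ := towerStep L M)
      (fun _ => rfl), ← ih]
    exact congrArg (specTower M) (reduction_ext _)

/-- `Π_ω` restricts to `Π_{N,0}` on `ℙⁿ(K_N)`. -/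
theorem specialisation_ext (N : ℕ) (q : PSpace (TowerField L N) n) :
    specialisation (PSpace.ext (toKOmega L N) q) = specTower N q := by
  set p := PSpace.ext (toKOmega L N) q with hp
  have h := (exists_tower_point p).choose_spec.choose_spec
  rw [specialisation]
  set N' := (exists_tower_point p).choose
  set q' := (exists_tower_point p).choose_spec.choose
  rw [← specTower_towerMap (le_max_left N' N) q', ← specTower_towerMap (le_max_right N' N) q]
  congr 1
  apply PSpace.ext_injective (toKOmega L (max N' N))
  rw [PSpace.ext_ext (toKOmega_towerMap _), PSpace.ext_ext (toKOmega_towerMap _), h]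

end Tower

/-! ### Closed subvarieties of products of projective spaces

Points of the product of the projective spaces `ℙⁿ` over an index set `ι` are families
`ι → PSpace L n`. With `L` algebraically closed a subvariety defined over `L` is identified with
its set of `L`-points. -/

section Varieties

variable {L : Type u} [Field L] {n : ℕ} {ι : Type}

/-- Multihomogeneous polynomials in the coordinates of the product of the spaces `ℙⁿ` over `ι`:
homogeneous in each of the blocks of variables `(X_{i,0}, …, X_{i,n})`. -/
def IsMultihomogeneous (f : MvPolynomial (ι × Fin (n + 1)) L) : Prop :=
  ∃ d : ι →₀ ℕ, f.IsWeightedHomogeneous (fun p => Finsupp.single p.1 1) d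

/-- A polynomial over `L` vanishes at (the chosen homogeneous coordinates of) a point with values
in an extension `K` of `L`. For multihomogeneous polynomials this does not depend on the choice of
homogeneous coordinates. -/
def VanishesAt {K : Type u} [Field K] [Algebra L K] (f : MvPolynomial (ι × Fin (n + 1)) L)
    (x : ι → PSpace K n) : Prop :=
  MvPolynomial.aeval (fun p : ι × Fin (n + 1) => (x p.1).rep p.2) f = 0

/-- Zariski closed subsets: zero sets of families of multihomogeneous polynomials. -/
def IsZariskiClosed (W : Set (ι → PSpace L n)) : Prop :=
  ∃ S : Set (MvPolynomial (ι × Fin (n + 1)) L),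
    (∀ f ∈ S, IsMultihomogeneous f) ∧ W = {x | ∀ f ∈ S, VanishesAt f x}

/-- The set `W(K)` of `K`-points of the closed subvariety `W`, for an extension `K` of `L`: the
common zeros of all multihomogeneous polynomials over `L` that vanish on `W`. -/
def points (K : Type u) [Field K] [Algebra L K] (W : Set (ι → PSpace L n)) :
    Set (ι → PSpace K n) :=
  {x | ∀ f : MvPolynomial (ι × Fin (n + 1)) L, IsMultihomogeneous f →
    (∀ y ∈ W, VanishesAt f y) → VanishesAt f x}

/-- `W` is irreducible in the Zariski topology. -/
def IsIrreducibleSet (W : Set (ι → PSpace L n)) : Prop :=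
  W.Nonempty ∧ ∀ Z₁ Z₂ : Set (ι → PSpace L n), IsZariskiClosed Z₁ → IsZariskiClosed Z₂ →
    W ⊆ Z₁ ∪ Z₂ → W ⊆ Z₁ ∨ W ⊆ Z₂

/-- The part of `W` in the affine chart where the coordinate `X_{i, c i}` does not vanish for all
`i`, as a subset of affine space: the coordinates are normalised by `X_{i, c i} = 1`. -/
def chart (W : Set (ι → PSpace L n)) (c : ι → Fin (n + 1)) : Set (ι × Fin (n + 1) → L) :=
  {v | (∀ i, v (i, c i) = 1) ∧ ∃ hv : ∀ i, (fun j => v (i, j)) ≠ 0,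
    (fun i => Projectivization.mk L (fun j => v (i, j)) (hv i)) ∈ W}

/-- The ring of regular functions on the affine variety `chart W c`. -/
abbrev ChartRing (W : Set (ι → PSpace L n)) (c : ι → Fin (n + 1)) : Type u :=
  MvPolynomial (ι × Fin (n + 1)) L ⧸ MvPolynomial.vanishingIdeal L (chart W c)

/-- The closed subvariety `W` is smooth: the coordinate rings of its standard affine charts are
smooth `L`-algebras. -/
def IsSmoothVariety (W : Set (ι → PSpace L n)) : Prop :=
  ∀ c : ι → Fin (n + 1), Algebra.Smooth L (ChartRing W c)

/-- The power `V^ι` of a subset `V` of `ℙⁿ(L)`. -/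
def power (V : Set (PSpace L n)) (ι : Type) : Set (ι → PSpace L n) := {x | ∀ i, x i ∈ V}

/-- `V ⊂ ℙⁿ` is a smooth projective variety over `L`. -/
def IsSmoothProjective (V : Set (PSpace L n)) : Prop :=
  IsZariskiClosed (power V Unit) ∧ IsSmoothVariety (power V Unit)

/-- `F` is a subset of `D × V^κ` which is a finite cover of `D`: it is Zariski closed, its image
under the projection to the first factor is `D`, and the fibres of this projection are finite. -/
structure IsFiniteCover {κ : Type} (V : Set (PSpace L n)) (D : Set (ι → PSpace L n))
    (F : Set (ι ⊕ κ → PSpace L n)) : Prop where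
  isZariskiClosed : IsZariskiClosed F
  subset_prod : ∀ x ∈ F, x ∘ Sum.inl ∈ D ∧ x ∘ Sum.inr ∈ power V κ
  image_eq : {a | ∃ b, Sum.elim a b ∈ F} = D
  finite_fibre : ∀ a ∈ D, {b : κ → PSpace L n | Sum.elim a b ∈ F}.Finite

/-- The locus over `L` of a point `x` with values in an extension `K` of `L`: the intersection of
all closed subvarieties defined over `L` that contain `x`. -/
def locus {K : Type u} [Field K] (L : Type u) [Field L] [Algebra L K] (x : ι → PSpace K n) :
    Set (ι → PSpace K n) :=
  {y | ∀ W : Set (ι → PSpace L n), IsZariskiClosed W → x ∈ points K W → y ∈ points K W}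

/-- `x ∈ W(K)` is generic in `W` over `L`. -/
def IsGeneric {K : Type u} [Field K] [Algebra L K] (W : Set (ι → PSpace L n))
    (x : ι → PSpace K n) : Prop :=
  locus L x = points K W

/-- The infinitesimal neighbourhood of a point `a` of `V(L)^ι`: the set of points of `V(K_ω)^ι`
whose image under the specialisation map is `a`. -/
def infNbhd {L : Type u} [Field L] [IsAlgClosed L] (V : Set (PSpace L n)) (a : ι → PSpace L n) :
    Set (ι → PSpace (KOmega L) n) :=
  {a' | a' ∈ points (KOmega L) (power V ι) ∧ ∀ i, specialisation (a' i) = a i}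

end Varieties

end ZariskiSpec

/-!
The elements of `K_ω` that specialise to an element of `L` form a valuation ring `O` with residue
field `L`, and `Π_ω` is reduction modulo its maximal ideal. In affine charts around `a` and `(a, b)`
the coordinate ring `A` of `D` is smooth over `L`, that of `F` is a domain `B` of finite type over
`A`, and `A → B` is injective since a nonempty chart of `F` is dense. The coordinates of `a'` define
a map `α : A → O` lifting the point `a`, and `α` is injective because `a'` is generic. What has to
be shown is that `α` extends to a map `B → O` lifting the point `(a, b)`.

Near `a` the algebra `A` is étale over a polynomial ring `P`, which is integrally closed. As the
fibre of `F → D` is finite, `B` is quasi-finite over `P` at `(a, b)`, so by Zariski's main theorem it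
agrees near this point with a finite extension `C` of `P`. Going down for `P ⊂ C` is proved directly
(`exists_algHom_comp_eq_of_finite`): the maps `C → K_ω` over `P` are finite in number, and all have
values in `O`. If none of them had residue `(a, b)`, some `x ∈ C` would vanish at `(a, b)` but not at
any of their residues. The constant term of the minimal polynomial of `x` over `P` is the product of
the conjugates of `x`, a unit of `O`; but it vanishes at `(a, b)`. The resulting map `B → O` agrees
with `α` on `P`, hence on `A`, because maps from an unramified algebra to `O` are determined by their
residues (`algHom_eq_of_formallyUnramified`). In this way normality of `D` enters only through the
polynomial ring `P`.

The passage between multihomogeneous equations and charts uses multihomogenisation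
(`exists_multihomogenisation`); the Nullstellensatz turns genericity into injectivity of `α`
(`mem_vanishingIdeal_of_isGeneric`).
-/

/-! ### Lifting points along quasi-finite extensions of smooth algebras -/

section SpecialisationLifting

open Polynomial

/-- A point `χ` of a finite extension `C` of an integrally closed domain `P` is the residue of
an extension of `P → O` to `C`, if it lies over the residue of `P → O`. The residues of the finitely
many extensions exhaust the points over that of `P → O`, since the constant term of the minimal
polynomial of `x ∈ C` over `P` is up to sign a product of conjugates of `x`. -/
theorem exists_algHom_comp_eq_of_finite {L P C O K : Type*} [Field L] [CommRing P] [IsDomain P]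
    [IsIntegrallyClosed P] [CommRing C] [IsDomain C] [Algebra P C] [Module.Finite P C]
    [FaithfulSMul P C] [CommRing O] [Field K] [IsAlgClosed K] [Algebra P O] [Algebra O K]
    [Algebra P K] [IsScalarTower P O K] [FaithfulSMul P K] [IsIntegrallyClosedIn O K]
    (ρ : O →+* L) (χ : C →+* L) (h : ∀ p, ρ (algebraMap P O p) = χ (algebraMap P C p))
    (hs : Function.Surjective fun p => χ (algebraMap P C p)) :
    ∃ ψ : C →ₐ[P] O, ∀ x, ρ (ψ x) = χ x := by
  classical
  let M := FractionRing P
  let E := FractionRing C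
  let : Algebra M E := FractionRing.liftAlgebra P E
  have : IsScalarTower P M E := FractionRing.isScalarTower_liftAlgebra P E
  let : Algebra M K := FractionRing.liftAlgebra P K
  have : IsScalarTower P M K := FractionRing.isScalarTower_liftAlgebra P K
  have : FiniteDimensional M E := .of_isLocalization P C (nonZeroDivisors P)
  have hOinj : Function.Injective (algebraMap O K) :=
    (isIntegrallyClosedIn_iff.1 (inferInstance : IsIntegrallyClosedIn O K)).1
  -- Every embedding of the field of fractions of `C` maps `C` to `O`.
  have hlift : ∀ σ : E →ₐ[M] K, ∃ ψ : C →ₐ[P] O, ∀ x, algebraMap O K (ψ x) =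
      σ (algebraMap C E x) := by
    intro σ
    have hx : ∀ x : C, ∃ y : O, algebraMap O K y = σ (algebraMap C E x) := fun x =>
      IsIntegrallyClosedIn.algebraMap_eq_of_integral <| by
        have h1 : IsIntegral P x := Algebra.IsIntegral.isIntegral x
        have h2 := (h1.algebraMap (B := E)).map (σ.restrictScalars P)
        exact h2.tower_top
    choose g hg using hx
    refine ⟨{ toFun := g
              map_one' := ?_
              map_mul' := ?_
              map_zero' := ?_
              map_add' := ?_
              commutes' := ?_ }, hg⟩
    · exact hOinj (by simp [hg])
    · exact fun x y => hOinj (by simp [hg])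
    · exact hOinj (by simp [hg])
    · exact fun x y => hOinj (by simp [hg])
    · intro p
      apply hOinj
      rw [hg, ← IsScalarTower.algebraMap_apply P C E, ← IsScalarTower.algebraMap_apply P O K,
        IsScalarTower.algebraMap_apply P M E, AlgHom.commutes, ← IsScalarTower.algebraMap_apply]
  choose ψ hψ using hlift
  by_contra! hcon
  have : Finite (E →ₐ[M] K) := inferInstance
  have := Fintype.ofFinite (E →ₐ[M] K)
  -- By prime avoidance some `c` vanishes at `χ` but at none of the finitely many residues.
  obtain ⟨c, hc, hcσ⟩ : ∃ c, χ c = 0 ∧ ∀ σ, ρ (ψ σ c) ≠ 0 := by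
    by_contra! hne
    have hsub : ((RingHom.ker χ : Ideal C) : Set C) ⊆ ⋃ σ ∈ ((Finset.univ : Finset (E →ₐ[M] K)) :
        Set (E →ₐ[M] K)), (RingHom.ker (ρ.comp (ψ σ : C →+* O)) : Ideal C) := by
      intro c hc
      obtain ⟨σ, hσ⟩ := hne c hc
      exact Set.mem_biUnion (Finset.mem_coe.2 (Finset.mem_univ σ)) hσ
    have hne' : Nonempty (E →ₐ[M] K) := (hne 0 (map_zero _)).nonempty
    obtain ⟨σ, -, hσ⟩ := (Ideal.subset_union_prime hne'.some hne'.some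
      fun σ _ _ _ => RingHom.ker_isPrime _).1 hsub
    obtain ⟨x, hx⟩ := hcon (ψ σ)
    obtain ⟨p, hp⟩ := hs (χ x)
    have h1 : x - algebraMap P C p ∈ RingHom.ker χ := by
      rw [RingHom.mem_ker, map_sub, sub_eq_zero]
      exact hp.symm
    have h2 := hσ h1
    rw [RingHom.mem_ker, map_sub, sub_eq_zero] at h2
    apply hx
    have h3 : ρ (ψ σ x) = ρ (ψ σ (algebraMap P C p)) := h2
    rw [h3, AlgHom.commutes, h]
    exact hp
  have hint : IsIntegral P c := Algebra.IsIntegral.isIntegral c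
  set μ := minpoly P c with hμ
  have hmon : μ.Monic := minpoly.monic hint
  have hroots : ∀ z ∈ (μ.map (algebraMap P K)).roots, ∃ σ, z = algebraMap O K (ψ σ c) := by
    intro z hz
    have hz0 := (mem_roots'.1 hz).2
    obtain ⟨σ, hσ⟩ := IntermediateField.exists_algHom_of_splits_of_aeval (F := M) (E := E) (K := K)
      (fun s => ⟨Algebra.IsIntegral.isIntegral s, IsAlgClosed.splits _⟩)
      (x := algebraMap C E c) (y := z) (by
        rw [minpoly.isIntegrallyClosed_eq_field_fractions M E hint, aeval_map_algebraMap]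
        simpa [IsRoot, eval_map_algebraMap] using hz0)
    exact ⟨σ, by rw [hψ, hσ]⟩
  -- The constant term of the minimal polynomial is up to sign the product of the conjugates.
  have hcoeff := (IsAlgClosed.splits (μ.map (algebraMap P K))).coeff_zero_eq_prod_roots_of_monic
    (hmon.map _)
  obtain ⟨s, hs', hsρ⟩ : ∃ s : O, algebraMap O K s = (μ.map (algebraMap P K)).roots.prod ∧
      ρ s ≠ 0 := by
    revert hroots
    clear hcoeff
    induction (μ.map (algebraMap P K)).roots using Multiset.induction_on with
    | empty => exact fun _ => ⟨1, by simp⟩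
    | cons a t ih =>
      intro hr
      obtain ⟨s, hs1, hs2⟩ := ih fun z hz => hr z (Multiset.mem_cons_of_mem hz)
      obtain ⟨σ, hσ⟩ := hr a (Multiset.mem_cons_self _ _)
      refine ⟨ψ σ c * s, by rw [map_mul, hs1, Multiset.prod_cons, hσ], ?_⟩
      rw [map_mul]
      exact mul_ne_zero (hcσ σ) hs2
  have h0 : algebraMap P O (μ.coeff 0) = (-1) ^ (μ.map (algebraMap P K)).natDegree * s := by
    apply hOinj
    rw [← IsScalarTower.algebraMap_apply, ← coeff_map, hcoeff, map_mul, hs']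
    simp
  have h1 : ρ (algebraMap P O (μ.coeff 0)) ≠ 0 := by
    rw [h0, map_mul, map_pow, map_neg, map_one]
    exact mul_ne_zero (pow_ne_zero _ (neg_ne_zero.2 one_ne_zero)) hsρ
  have h2 : χ (aeval c μ) = 0 := by rw [hμ, minpoly.aeval, map_zero]
  rw [aeval_def, hom_eval₂, hc, eval₂_at_zero] at h2
  rw [h] at h1
  exact h1 h2

/-- Two points with values in `O` of an unramified algebra agree if their residues do. -/
theorem algHom_eq_of_formallyUnramified {P A O L : Type*} [CommRing P] [CommRing A] [Algebra P A]
    [Algebra.EssFiniteType P A] [Algebra.FormallyUnramified P A] [CommRing O] [IsDomain O]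
    [Algebra P O] [Field L] (ρ : O →+* L) (α β : A →ₐ[P] O) (h : ∀ x, ρ (α x) = ρ (β x)) :
    α = β := by
  obtain ⟨t, ht, ht1⟩ := Algebra.FormallyUnramified.iff_exists_tensorProduct.1
    (inferInstance : Algebra.FormallyUnramified P A)
  let γ : TensorProduct P A A →ₐ[P] O := Algebra.TensorProduct.lift α β fun _ _ => .all _ _
  have hρ : ∀ z, ρ (γ z) = ρ (α (Algebra.TensorProduct.lmul' P z)) := by
    intro z
    induction z with
    | zero => simp
    | add x y hx hy => simp only [map_add, hx, hy]
    | tmul x y => simp [γ, h]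
  have hγt : γ t ≠ 0 := by
    intro h0
    have := hρ t
    rw [h0, ht1] at this
    simp at this
  ext s
  have := congrArg γ (ht s)
  rw [map_mul, map_zero, mul_eq_zero, or_iff_left hγt] at this
  simp only [γ, map_sub, Algebra.TensorProduct.lift_tmul, map_one, one_mul, mul_one,
    sub_eq_zero] at this
  exact this.symm

/-- An algebra of finite type over an algebraically closed field is quasi-finite over an
algebra `A` at a point `χ` if only finitely many points have the same image as `χ`: by the Jacobson
property the primes in the fibre are the kernels of these points, so the fibre is discrete. -/
theorem quasiFiniteAt_ker_of_finite {L A B : Type*} [Field L] [IsAlgClosed L] [CommRing A]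
    [CommRing B] [Algebra L A] [Algebra L B] [Algebra A B] [IsScalarTower L A B]
    [Algebra.FiniteType L B] (χ : B →ₐ[L] L)
    (hfin : {χ' : B →ₐ[L] L | ∀ x : A, χ' (algebraMap A B x) = χ (algebraMap A B x)}.Finite) :
    @Algebra.QuasiFiniteAt A B _ _ _ (RingHom.ker χ) (RingHom.ker_isPrime _) := by
  have : Algebra.FiniteType A B := .of_restrictScalars_finiteType L A B
  have : IsJacobsonRing B := isJacobsonRing_of_finiteType (A := L)
  have : (RingHom.ker χ).IsPrime := RingHom.ker_isPrime _
  let q : PrimeSpectrum B := ⟨RingHom.ker χ, inferInstance⟩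
  -- A maximal ideal in the fibre is the kernel of one of the finitely many points.
  have hker : ∀ m : Ideal B, m.IsMaximal → (RingHom.ker χ).comap (algebraMap A B) ≤
      m.comap (algebraMap A B) → ∃ χ' ∈ {χ' : B →ₐ[L] L | ∀ x : A, χ' (algebraMap A B x) =
        χ (algebraMap A B x)}, m = RingHom.ker χ' := by
    intro m hm hle
    let := Ideal.Quotient.field m
    have : Algebra.FiniteType L (B ⧸ m) := inferInstance
    have : Module.Finite L (B ⧸ m) := finite_of_finite_type_of_isJacobsonRing L (B ⧸ m)
    let e := AlgEquiv.ofBijective (Algebra.ofId L (B ⧸ m))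
      (IsAlgClosed.algebraMap_bijective_of_isIntegral)
    let χ' : B →ₐ[L] L := (e.symm : (B ⧸ m) →ₐ[L] L).comp (Ideal.Quotient.mkₐ L m)
    have hχ' : RingHom.ker χ' = m := by
      ext x
      rw [RingHom.mem_ker]
      change e.symm (Ideal.Quotient.mk m x) = 0 ↔ _
      rw [EmbeddingLike.map_eq_zero_iff, Ideal.Quotient.eq_zero_iff_mem]
    refine ⟨χ', fun x => ?_, hχ'.symm⟩
    have hx : x - algebraMap L A (χ (algebraMap A B x)) ∈
        (RingHom.ker χ).comap (algebraMap A B) := by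
      rw [Ideal.mem_comap, RingHom.mem_ker, map_sub, map_sub,
        ← IsScalarTower.algebraMap_apply L A B, AlgHom.commutes]
      simp
    have := hle hx
    rw [← hχ', Ideal.mem_comap, RingHom.mem_ker, map_sub, map_sub,
      ← IsScalarTower.algebraMap_apply L A B, AlgHom.commutes, sub_eq_zero] at this
    simpa using this
  have hmax : ∀ p : PrimeSpectrum B, p.comap (algebraMap A B) = q.comap (algebraMap A B) →
      ∃ χ' ∈ {χ' : B →ₐ[L] L | ∀ x : A, χ' (algebraMap A B x) =
        χ (algebraMap A B x)}, p.asIdeal = RingHom.ker χ' := by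
    intro p hp
    have hp' : p.asIdeal.comap (algebraMap A B) = (RingHom.ker χ).comap (algebraMap A B) :=
      congrArg PrimeSpectrum.asIdeal hp
    obtain ⟨χ', hχ', hle⟩ : ∃ χ' ∈ {χ' : B →ₐ[L] L | ∀ x : A, χ' (algebraMap A B x) =
        χ (algebraMap A B x)}, RingHom.ker χ' ≤ p.asIdeal := by
      suffices h : hfin.toFinset.inf (fun χ' : B →ₐ[L] L => RingHom.ker χ') ≤ p.asIdeal by
        obtain ⟨χ', hχ', hle⟩ := (Ideal.IsPrime.inf_le' p.isPrime).1 h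
        exact ⟨χ', hfin.mem_toFinset.1 hχ', hle⟩
      have hj : p.asIdeal.jacobson = p.asIdeal :=
        IsJacobsonRing.out inferInstance p.isPrime.isRadical
      intro x hx
      rw [← hj, Ideal.jacobson, Ideal.mem_sInf]
      rintro m ⟨hpm, hm⟩
      obtain ⟨χ', hχ', rfl⟩ := hker m hm (hp' ▸ Ideal.comap_mono hpm)
      exact (Finset.inf_le (hfin.mem_toFinset.2 hχ') : _ ≤ RingHom.ker χ') hx
    refine ⟨χ', hχ', (Ideal.IsMaximal.eq_of_le ?_ p.isPrime.ne_top hle).symm⟩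
    exact RingHom.ker_isMaximal_of_surjective _ fun l => ⟨algebraMap L B l, by simp⟩
  refine Algebra.QuasiFiniteAt.of_isOpen_singleton_fiber q ?_
  let T := {p : PrimeSpectrum B // p ∈ PrimeSpectrum.comap (algebraMap A B) ⁻¹'
    {q.comap (algebraMap A B)}}
  have : Finite T := by
    refine Set.Finite.subset (hfin.image fun χ' : B →ₐ[L] L =>
      (⟨RingHom.ker χ', RingHom.ker_isPrime _⟩ : PrimeSpectrum B)) ?_
    intro p hp
    obtain ⟨χ', hχ', h⟩ := hmax p hp
    exact ⟨χ', hχ', PrimeSpectrum.ext h.symm⟩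
  have : T1Space T := by
    refine ⟨fun p => ?_⟩
    have hp : IsClosed {p.1} := by
      rw [PrimeSpectrum.isClosed_singleton_iff_isMaximal]
      obtain ⟨χ', -, h⟩ := hmax p.1 p.2
      rw [h]
      exact RingHom.ker_isMaximal_of_surjective _ fun l => ⟨algebraMap L B l, by simp⟩
    have := hp.preimage (continuous_subtype_val (p := fun p => p ∈ PrimeSpectrum.comap
      (algebraMap A B) ⁻¹' {q.comap (algebraMap A B)}))
    convert! this
    ext r
    exact Subtype.ext_iff
  have : DiscreteTopology T := inferInstance
  exact isOpen_discrete (α := T) _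

theorem awayMap_algebraMap {R S : Type*} [CommRing R] [CommRing S] (f : R →+* S) (r x : R) :
    Localization.awayMap f r (algebraMap R (Localization.Away r) x) =
      algebraMap S (Localization.Away (f r)) (f x) :=
  IsLocalization.map_eq (S := Localization.Away r) (Q := Localization.Away (f r)) _ x

/-- The lifting theorem for an algebra `A` that is étale over an integrally closed domain `P`.
By Zariski's main theorem `B` is near `χ` a localisation of a finite extension of `P`, so
`P → O` lifts to `B`; as `A` is unramified over `P`, the lift extends `α`. -/
theorem exists_algHom_lift_of_etale {L P A B O K : Type*} [Field L] [IsAlgClosed L] [CommRing P]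
    [IsDomain P] [IsIntegrallyClosed P] [Algebra L P] [CommRing A] [Algebra L A] [Algebra P A]
    [IsScalarTower L P A] [Algebra.Etale P A] [CommRing B] [IsDomain B] [Algebra L B]
    [Algebra A B] [IsScalarTower L A B] [Algebra.FiniteType L B] [FaithfulSMul A B]
    [CommRing O] [IsDomain O] [Algebra L O] [Field K] [IsAlgClosed K] [Algebra O K]
    [IsIntegrallyClosedIn O K] (ρ : O →ₐ[L] L) (hρ : ∀ x, ρ x ≠ 0 → IsUnit x) (χ : B →ₐ[L] L)
    (hfin : {χ' : B →ₐ[L] L | ∀ x : A, χ' (algebraMap A B x) = χ (algebraMap A B x)}.Finite)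
    (α : A →ₐ[L] O) (hα : Function.Injective α) (h : ∀ x, ρ (α x) = χ (algebraMap A B x)) :
    ∃ β : B →ₐ[L] O, (∀ x, β (algebraMap A B x) = α x) ∧ ∀ x, ρ (β x) = χ x := by
  let : Algebra P B := ((algebraMap A B).comp (algebraMap P A)).toAlgebra
  have : IsScalarTower P A B := .of_algebraMap_eq fun _ => rfl
  have : IsScalarTower L P B := .of_algebraMap_eq fun x => by
    rw [IsScalarTower.algebraMap_apply P A B, ← IsScalarTower.algebraMap_apply L P A,
      ← IsScalarTower.algebraMap_apply]
  have : Algebra.FiniteType P B := .of_restrictScalars_finiteType L P B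
  have : IsDomain A := (FaithfulSMul.algebraMap_injective A B).isDomain
  have hPA : Function.Injective (algebraMap P A) := FaithfulSMul.algebraMap_injective P A
  have hPB : Function.Injective (algebraMap P B) :=
    (FaithfulSMul.algebraMap_injective A B).comp hPA
  have hOinj : Function.Injective (algebraMap O K) :=
    (isIntegrallyClosedIn_iff.1 (inferInstance : IsIntegrallyClosedIn O K)).1
  let : Algebra P O := ((α : A →+* O).comp (algebraMap P A)).toAlgebra
  let : Algebra P K := ((algebraMap O K).comp (algebraMap P O)).toAlgebra
  have : IsScalarTower P O K := .of_algebraMap_eq fun _ => rfl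
  have : FaithfulSMul P K :=
    (faithfulSMul_iff_algebraMap_injective P K).2 (hOinj.comp (hα.comp hPA))
  have : (RingHom.ker χ).IsPrime := RingHom.ker_isPrime _
  have : Algebra.QuasiFiniteAt A (RingHom.ker χ) := quasiFiniteAt_ker_of_finite χ hfin
  have : Algebra.QuasiFiniteAt P (RingHom.ker χ) := .trans P A _
  obtain ⟨C, hC, r, hr, hbij⟩ :=
    Algebra.QuasiFiniteAt.exists_fg_and_exists_notMem_and_awayMap_bijective (R := P)
      (RingHom.ker χ)
  have : Module.Finite P C := ⟨(Submodule.fg_top _).2 hC⟩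
  have : FaithfulSMul P C := (faithfulSMul_iff_algebraMap_injective P C).2 fun x y hxy =>
    hPB (congrArg Subtype.val hxy)
  obtain ⟨ψ, hψ⟩ := exists_algHom_comp_eq_of_finite (P := P) (C := C) (K := K) (ρ : O →+* L)
    ((χ : B →+* L).comp C.val.toRingHom) (fun p => h (algebraMap P A p)) (fun l =>
      ⟨algebraMap L P l, by
        change χ (algebraMap P B (algebraMap L P l)) = l
        rw [← IsScalarTower.algebraMap_apply, AlgHom.commutes]
        rfl⟩)
  have hψr : IsUnit (ψ r) := hρ _ (by
    have := hψ r
    change ρ (ψ r) = χ r.1 at this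
    rwa [this])
  let e := RingEquiv.ofBijective _ hbij
  let β₀ : B →+* O := ((IsLocalization.Away.lift (S := Localization.Away r) r
    (g := (ψ : C →+* O)) hψr).comp (e.symm : _ →+* _)).comp
      (algebraMap B (Localization.Away (C.val.toRingHom r)))
  have hβψ : ∀ c : C, β₀ c = ψ c := by
    intro c
    have : e.symm (algebraMap B (Localization.Away (C.val.toRingHom r)) c) =
        algebraMap C (Localization.Away r) c := by
      rw [RingEquiv.symm_apply_eq]
      exact (awayMap_algebraMap C.val.toRingHom r c).symm
    change IsLocalization.Away.lift (S := Localization.Away r) r (g := (ψ : C →+* O)) hψr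
      (e.symm (algebraMap B (Localization.Away (C.val.toRingHom r)) c)) = _
    rw [this]
    exact IsLocalization.Away.lift_eq r (g := (ψ : C →+* O)) hψr c
  have hβP : ∀ p : P, β₀ (algebraMap P B p) = algebraMap P O p := fun p =>
    (hβψ (algebraMap P C p)).trans (ψ.commutes p)
  let β : B →ₐ[L] O := { β₀ with
    commutes' := fun l => by
      change β₀ (algebraMap L B l) = _
      rw [IsScalarTower.algebraMap_apply L P B, hβP, RingHom.algebraMap_toAlgebra,
        RingHom.comp_apply, ← IsScalarTower.algebraMap_apply]
      exact α.commutes l }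
  have hres : ∀ x, ρ (β x) = χ x := by
    intro x
    obtain ⟨c, m, hc⟩ := Localization.awayMap_surjective_iff.1 hbij.2 x
    have hc' : (c : B) = (r : B) ^ m * x := hc
    have h1 : ∀ c : C, ρ (β c) = χ c := fun c => (congrArg ρ (hβψ c)).trans (hψ c)
    have h2 := h1 c
    rw [hc', map_mul, map_mul, map_mul, map_pow, map_pow, map_pow, h1] at h2
    exact mul_left_cancel₀ (pow_ne_zero m hr) h2
  refine ⟨β, fun x => ?_, hres⟩
  let βA : A →ₐ[P] O := { β₀.comp (algebraMap A B) with
    commutes' := fun p => by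
      change β₀ (algebraMap A B (algebraMap P A p)) = _
      rw [← IsScalarTower.algebraMap_apply, hβP] }
  let αP : A →ₐ[P] O := { (α : A →+* O) with commutes' := fun _ => rfl }
  have heq : βA = αP := algHom_eq_of_formallyUnramified (ρ : O →+* L) βA αP fun x =>
    (hres (algebraMap A B x)).trans (h x).symm
  exact congrArg (fun γ : A →ₐ[P] O => γ x) heq

/-- Let `B` be a domain of finite type over the smooth algebra `A`, and `χ` a point of `B`
isolated in its fibre over `A`. If `α` is an injective point of `A` with values in an integrally
closed local ring `O`, whose residue is the image of `χ`, then `α` lifts to a point of `B` with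
residue `χ`. -/
theorem exists_algHom_lift_of_smooth {L A B O K : Type*} [Field L] [IsAlgClosed L] [CommRing A]
    [Algebra L A] [Algebra.Smooth L A] [CommRing B] [IsDomain B] [Algebra L B]
    [Algebra A B] [IsScalarTower L A B] [Algebra.FiniteType L B] [FaithfulSMul A B]
    [CommRing O] [IsDomain O] [Algebra L O] [Field K] [IsAlgClosed K] [Algebra O K]
    [IsIntegrallyClosedIn O K] (ρ : O →ₐ[L] L) (hρ : ∀ x, ρ x ≠ 0 → IsUnit x) (χ : B →ₐ[L] L)
    (hfin : {χ' : B →ₐ[L] L | ∀ x : A, χ' (algebraMap A B x) = χ (algebraMap A B x)}.Finite)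
    (α : A →ₐ[L] O) (hα : Function.Injective α) (h : ∀ x, ρ (α x) = χ (algebraMap A B x)) :
    ∃ β : B →ₐ[L] O, (∀ x, β (algebraMap A B x) = α x) ∧ ∀ x, ρ (β x) = χ x := by
  have hprime : (RingHom.ker (χ.comp (IsScalarTower.toAlgHom L A B))).IsPrime :=
    RingHom.ker_isPrime _
  obtain ⟨f, hf, hstd⟩ := Algebra.IsSmoothAt.exists_notMem_isStandardSmooth L
    (RingHom.ker (χ.comp (IsScalarTower.toAlgHom L A B)))
  have hf : χ (algebraMap A B f) ≠ 0 := hf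
  have : IsDomain A := (FaithfulSMul.algebraMap_injective A B).isDomain
  let A' := Localization.Away f
  let B' := Localization.Away (algebraMap A B f)
  obtain ⟨n, g, hg, hget⟩ := RingHom.IsStandardSmooth.exists_etale_mvPolynomial
    (f := algebraMap L A') (RingHom.isStandardSmooth_algebraMap.2 hstd)
  let : Algebra (MvPolynomial (Fin n) L) A' := g.toAlgebra
  have : IsScalarTower L (MvPolynomial (Fin n) L) A' := .of_algebraMap_eq' hg.symm
  have : Algebra.Etale (MvPolynomial (Fin n) L) A' := hget
  let : Algebra A' B' := (Localization.awayMap (algebraMap A B) f).toAlgebra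
  have hAB' : ∀ x : A, algebraMap A' B' (algebraMap A A' x) =
      algebraMap B B' (algebraMap A B x) := awayMap_algebraMap (algebraMap A B) f
  have : IsScalarTower L A' B' := .of_algebraMap_eq fun l => by
    rw [IsScalarTower.algebraMap_apply L A A', hAB', ← IsScalarTower.algebraMap_apply L A B,
      ← IsScalarTower.algebraMap_apply]
  have hf0 : algebraMap A B f ≠ 0 := fun h0 => hf (by rw [h0, map_zero])
  have : IsDomain B' := IsLocalization.isDomain_localization
    (powers_le_nonZeroDivisors_of_noZeroDivisors hf0)
  have : Algebra.FiniteType L B' := inferInstanceAs (Algebra.FiniteType L (Localization.Away _))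
  have : FaithfulSMul A' B' := (faithfulSMul_iff_algebraMap_injective A' B').2
    (IsLocalization.map_injective_of_injective _ _ _ (FaithfulSMul.algebraMap_injective A B))
  let χ' : B' →ₐ[L] L := IsLocalization.liftAlgHom (M := Submonoid.powers (algebraMap A B f))
    (f := χ) (by
      rintro ⟨_, m, rfl⟩
      simpa using fun h0 => absurd h0 hf)
  have hχ' : ∀ x : B, χ' (algebraMap B B' x) = χ x := fun x =>
    IsLocalization.lift_eq (M := Submonoid.powers (algebraMap A B f)) _ x
  have hαf : IsUnit (α f) := hρ _ (by rwa [h])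
  let α' : A' →ₐ[L] O := IsLocalization.liftAlgHom (M := Submonoid.powers f) (f := α) (by
      rintro ⟨_, m, rfl⟩
      simpa using hαf.pow m)
  have hα' : ∀ x : A, α' (algebraMap A A' x) = α x := fun x =>
    IsLocalization.lift_eq (M := Submonoid.powers f) _ x
  have hext : ∀ χ₁ χ₂ : A' →ₐ[L] L, (∀ x : A, χ₁ (algebraMap A A' x) = χ₂ (algebraMap A A' x)) →
      χ₁ = χ₂ := fun χ₁ χ₂ h12 => AlgHom.coe_ringHom_injective
    (IsLocalization.ringHom_ext (Submonoid.powers f) (RingHom.ext h12))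
  obtain ⟨β', hβ', hres⟩ := exists_algHom_lift_of_etale (P := MvPolynomial (Fin n) L) (A := A')
    (B := B') (K := K) ρ hρ χ' (by
      refine Set.Finite.of_finite_image (f := fun χ₁ : B' →ₐ[L] L =>
        χ₁.comp (IsScalarTower.toAlgHom L B B')) (hfin.subset ?_) ?_
      · rintro _ ⟨χ₁, hχ₁, rfl⟩ x
        have := hχ₁ (algebraMap A A' x)
        rw [hAB', hχ'] at this
        exact this
      · intro χ₁ _ χ₂ _ h12
        refine AlgHom.coe_ringHom_injective (IsLocalization.ringHom_ext
          (Submonoid.powers (algebraMap A B f)) (RingHom.ext fun x => ?_))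
        exact DFunLike.congr_fun h12 x) α' (by
      refine (IsLocalization.lift_injective_iff _).2 fun x y => ?_
      rw [(IsLocalization.injective A' (M := Submonoid.powers f) ?_).eq_iff]
      · exact hα.eq_iff.symm
      · exact powers_le_nonZeroDivisors_of_noZeroDivisors fun h0 => hf (by
          rw [h0, map_zero, map_zero])) (fun x => by
      refine DFunLike.congr_fun (hext (ρ.comp α') (χ'.comp (IsScalarTower.toAlgHom L A' B'))
        fun x => ?_) x
      change ρ (α' (algebraMap A A' x)) = χ' (algebraMap A' B' (algebraMap A A' x))
      rw [hα', hAB', hχ', h])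
  refine ⟨β'.comp (IsScalarTower.toAlgHom L B B'), fun x => ?_, fun x => ?_⟩
  · change β' (algebraMap B B' (algebraMap A B x)) = _
    rw [← hAB', hβ', hα']
  · change ρ (β' (algebraMap B B' x)) = _
    rw [hres, hχ']

end SpecialisationLifting

namespace ZariskiSpec

/-! ### The place of `K_ω` with values in `L` -/

section Place

/-- The relation `S x c`, read as "`x` is finite with residue `c`", is a place of the field `K`
with values in `L`. -/
structure IsPlace {K L : Type*} [Field K] [Field L] (S : K → L → Prop) : Prop where
  zero : S 0 0
  one : S 1 1
  unique : ∀ {x c d}, S x c → S x d → c = d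
  add : ∀ {x y c d}, S x c → S y d → S (x + y) (c + d)
  mul : ∀ {x y c d}, S x c → S y d → S (x * y) (c * d)
  finite_or_inv : ∀ x, (∃ c, S x c) ∨ S x⁻¹ 0

/-- The place of `K((t))^alg` that sends `x` to the image under `S` of its residue in `K`. -/
def residueSpec {K : Type u} [Field K] {L : Type*} (S : K → L → Prop) (x : LaurentAlg K)
    (c : L) : Prop :=
  ∃ y : K, extNorm K (x - constHom K y) < 1 ∧ S y c

variable {K : Type u} [Field K] {L : Type*}

theorem residueSpec_constHom {S : K → L → Prop} {y : K} {c : L} :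
    residueSpec S (constHom K y) c ↔ S y c := by
  constructor
  · rintro ⟨z, hz, hzc⟩
    rwa [eq_of_extNorm_const_sub_lt hz]
  · intro h
    refine ⟨y, ?_, h⟩
    rw [sub_self, extNorm_zero]
    exact one_pos

theorem IsPlace.residueSpec [Field L] [IsAlgClosed K] {S : K → L → Prop} (hS : IsPlace S) :
    IsPlace (residueSpec S) where
  zero := by
    rw [← map_zero (constHom K), residueSpec_constHom]
    exact hS.zero
  one := by
    rw [← map_one (constHom K), residueSpec_constHom]
    exact hS.one
  unique := by
    rintro x c d ⟨y, hy, hyc⟩ ⟨z, hz, hzd⟩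
    have : y = z := by
      apply eq_of_extNorm_const_sub_lt
      have := extNorm_add_le (x - constHom _ z) (constHom _ y - x)
      rw [extNorm_sub_comm (constHom _ y), sub_add_sub_cancel'] at this
      exact this.trans_lt (max_lt hz hy)
    subst this
    exact hS.unique hyc hzd
  add := by
    rintro x y c d ⟨x', hx, hxc⟩ ⟨y', hy, hyd⟩
    refine ⟨x' + y', ?_, hS.add hxc hyd⟩
    have : x + y - constHom _ (x' + y') = (x - constHom _ x') + (y - constHom _ y') := by
      rw [map_add]; ring
    rw [this]
    exact (extNorm_add_le _ _).trans_lt (max_lt hx hy)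
  mul := by
    rintro x y c d ⟨x', hx, hxc⟩ ⟨y', hy, hyd⟩
    refine ⟨x' * y', ?_, hS.mul hxc hyd⟩
    have : x * y - constHom _ (x' * y') =
        (x - constHom _ x') * y + constHom _ x' * (y - constHom _ y') := by
      rw [map_mul]; ring
    rw [this]
    refine (extNorm_add_le _ _).trans_lt (max_lt ?_ ?_)
    · rw [extNorm_mul]
      exact mul_lt_one_of_nonneg_of_lt_one_left (extNorm_nonneg _) hx
        (extNorm_le_one_of_sub_lt hy)
    · rw [extNorm_mul]
      exact mul_lt_one_of_nonneg_of_lt_one_right (extNorm_const_le _) (extNorm_nonneg _) hy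
  finite_or_inv := by
    intro x
    rcases le_or_gt (extNorm K x) 1 with hx | hx
    · obtain ⟨y, hy⟩ := exists_residue x hx
      rcases hS.finite_or_inv y with ⟨c, hc⟩ | h0
      · exact Or.inl ⟨c, y, hy, hc⟩
      rcases eq_or_ne y 0 with rfl | hy0
      · exact Or.inl ⟨0, 0, hy, hS.zero⟩
      refine Or.inr ⟨y⁻¹, ?_, h0⟩
      have hx1 : extNorm K x = 1 := extNorm_eq_one_of_sub_lt hy0 hy
      have hx0 : x ≠ 0 := fun h => by
        rw [h, extNorm_zero] at hx1
        exact zero_ne_one hx1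
      have hcy : constHom K y ≠ 0 := (map_ne_zero _).2 hy0
      have hmul : x * constHom K y * (x⁻¹ - constHom _ y⁻¹) = constHom _ y - x := by
        rw [map_inv₀, mul_sub, mul_inv_cancel_right₀ hcy, mul_right_comm,
          mul_inv_cancel₀ hx0, one_mul]
      have := congrArg (extNorm K) hmul
      rw [extNorm_mul, extNorm_mul, hx1, extNorm_const hy0, one_mul, one_mul,
        extNorm_sub_comm (constHom _ y)] at this
      exact this.trans_lt hy
    · refine Or.inr ⟨0, ?_, hS.zero⟩
      rw [map_zero, sub_zero]
      have hx0 : x ≠ 0 := fun h => by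
        rw [h, extNorm_zero] at hx
        exact absurd hx (not_lt.2 zero_le_one)
      have h1 : extNorm K x * extNorm K x⁻¹ = 1 := by
        rw [← extNorm_mul, mul_inv_cancel₀ hx0, extNorm_one]
      by_contra! h2
      nlinarith

theorem reduction_mk_of_residue [IsAlgClosed K] {n : ℕ} {f : Fin (n + 1) → LaurentAlg K}
    (hf : f ≠ 0) {g : Fin (n + 1) → K} (hg : g ≠ 0)
    (h : ∀ j, extNorm K (f j - constHom K (g j)) < 1) :
    reduction (Projectivization.mk _ f hf) = Projectivization.mk _ g hg :=
  reduction_eq_iff.2 ⟨f, hf, g, hg, rfl, rfl, h⟩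

end Place

section TowerPlace

variable {L : Type u} [Field L] [IsAlgClosed L]

/-- `TowerSpec N x c`: the successive residues of `x ∈ K_N` in `K_{N-1}, …, K_0 = L` exist and
the last one is `c`. -/
def TowerSpec : (N : ℕ) → TowerField L N → L → Prop
  | 0 => Eq
  | N + 1 => residueSpec (TowerSpec N)

theorem isPlace_towerSpec (N : ℕ) : IsPlace (TowerSpec (L := L) N) := by
  induction N with
  | zero =>
    refine ⟨rfl, rfl, fun {x c d} h h' => h.symm.trans h', ?_, ?_, fun x => Or.inl ⟨x, rfl⟩⟩
    · rintro x y c d rfl rfl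
      rfl
    · rintro x y c d rfl rfl
      rfl
  | succ N ih => exact ih.residueSpec

theorem towerSpec_towerMap_iff {N M : ℕ} (h : N ≤ M) {y : TowerField L N} {c : L} :
    TowerSpec M (towerMap L N M h y) c ↔ TowerSpec N y c := by
  induction M, h using Nat.le_induction with
  | base => rw [towerMap_self]; rfl
  | succ M h ih =>
    rw [towerMap_succ L h, ← ih]
    exact residueSpec_constHom (K := TowerField L M)

theorem specTower_mk {n N : ℕ} {f : Fin (n + 1) → TowerField L N} (hf : f ≠ 0)
    {g : Fin (n + 1) → L} (hg : g ≠ 0) (h : ∀ j, TowerSpec N (f j) (g j)) :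
    specTower N (Projectivization.mk _ f hf) = Projectivization.mk _ g hg := by
  induction N with
  | zero =>
    obtain rfl : f = g := funext h
    rfl
  | succ N ih =>
    choose y hy hyg using h
    have hy0 : y ≠ 0 := by
      rintro rfl
      exact hg (funext fun j => (isPlace_towerSpec N).unique (hyg j) (isPlace_towerSpec N).zero)
    rw [← ih hy0 hyg]
    exact congrArg (specTower N) (reduction_mk_of_residue (K := TowerField L N) hf hy0 hy)

/-- The place of `K_ω` with values in `L`: `OmegaSpec x c` says that `x` specialises to `c`. -/
def OmegaSpec (x : KOmega L) (c : L) : Prop :=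
  ∃ (N : ℕ) (y : TowerField L N), toKOmega L N y = x ∧ TowerSpec N y c

theorem toKOmega_injective (N : ℕ) : Function.Injective (toKOmega L N) :=
  (toKOmega L N).injective

theorem exists_toKOmega_eq (x : KOmega L) : ∃ (N : ℕ) (y : TowerField L N), toKOmega L N y = x :=
  let ⟨N, y, h⟩ := DirectLimit.exists_eq_mk (towerMap L) x
  ⟨N, y, h.symm⟩

theorem omegaSpec_toKOmega_iff {N : ℕ} {y : TowerField L N} {c : L} :
    OmegaSpec (toKOmega L N y) c ↔ TowerSpec N y c := by
  refine ⟨fun ⟨M, z, hz, hzc⟩ => ?_, fun h => ⟨N, y, rfl, h⟩⟩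
  rw [← toKOmega_towerMap (le_max_left M N), ← toKOmega_towerMap (le_max_right M N)] at hz
  rw [← towerSpec_towerMap_iff (le_max_right M N), ← toKOmega_injective _ hz,
    towerSpec_towerMap_iff]
  exact hzc

/-- Finitely many elements of `K_ω` lie in a common `K_N`. -/
theorem exists_common_tower {ι : Type*} [Finite ι] (v : ι → KOmega L) :
    ∃ (N : ℕ) (w : ι → TowerField L N), ∀ j, toKOmega L N (w j) = v j := by
  have := Fintype.ofFinite ι
  choose i x hx using fun j => exists_toKOmega_eq (v j)
  refine ⟨Finset.univ.sup i, fun j => towerMap L (i j) _ (Finset.le_sup (Finset.mem_univ j)) (x j),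
    fun j => ?_⟩
  rw [toKOmega_towerMap, hx]

theorem isPlace_omegaSpec : IsPlace (OmegaSpec (L := L)) where
  zero := ⟨0, 0, map_zero _, (isPlace_towerSpec 0).zero⟩
  one := ⟨0, 1, map_one _, (isPlace_towerSpec 0).one⟩
  unique := by
    intro x c d hc hd
    obtain ⟨N, y, rfl⟩ := exists_toKOmega_eq x
    rw [omegaSpec_toKOmega_iff] at hc hd
    exact (isPlace_towerSpec N).unique hc hd
  add := by
    intro x y c d hc hd
    obtain ⟨N, w, hw⟩ := exists_common_tower ![x, y]
    obtain rfl : _ = x := hw 0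
    obtain rfl : _ = y := hw 1
    rw [← map_add]
    rw [omegaSpec_toKOmega_iff] at hc hd ⊢
    exact (isPlace_towerSpec N).add hc hd
  mul := by
    intro x y c d hc hd
    obtain ⟨N, w, hw⟩ := exists_common_tower ![x, y]
    obtain rfl : _ = x := hw 0
    obtain rfl : _ = y := hw 1
    rw [← map_mul]
    rw [omegaSpec_toKOmega_iff] at hc hd ⊢
    exact (isPlace_towerSpec N).mul hc hd
  finite_or_inv := by
    intro x
    obtain ⟨N, y, rfl⟩ := exists_toKOmega_eq x
    rw [← map_inv₀]
    simp only [omegaSpec_toKOmega_iff]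
    exact (isPlace_towerSpec N).finite_or_inv y

theorem omegaSpec_algebraMap (c : L) : OmegaSpec (algebraMap L (KOmega L) c) c :=
  ⟨0, c, rfl, rfl⟩

/-- `Π_ω` is computed by specialising homogeneous coordinates. -/
theorem specialisation_mk {n : ℕ} {f : Fin (n + 1) → KOmega L} (hf : f ≠ 0)
    {g : Fin (n + 1) → L} (hg : g ≠ 0) (h : ∀ j, OmegaSpec (f j) (g j)) :
    specialisation (Projectivization.mk _ f hf) = Projectivization.mk _ g hg := by
  obtain ⟨N, w, hw⟩ := exists_common_tower f
  obtain rfl : (fun j => toKOmega L N (w j)) = f := funext hw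
  have hw0 : w ≠ 0 := by
    rintro rfl
    exact hf (funext fun j => map_zero _)
  rw [← specTower_mk hw0 hg fun j => omegaSpec_toKOmega_iff.1 (h j), ← specialisation_ext]
  rfl

instance isAlgClosed_kOmega : IsAlgClosed (KOmega L) := by
  refine IsAlgClosed.of_exists_root _ fun p hp hirr => ?_
  obtain ⟨N, w, hw⟩ := exists_common_tower fun i : Fin (p.natDegree + 1) => p.coeff i
  have hlift : p ∈ Polynomial.lifts (toKOmega L N) := by
    rw [Polynomial.lifts_iff_coeff_lifts]
    intro i
    rcases lt_or_ge i (p.natDegree + 1) with hi | hi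
    · exact ⟨w ⟨i, hi⟩, hw ⟨i, hi⟩⟩
    · exact ⟨0, by rw [map_zero, Polynomial.coeff_eq_zero_of_natDegree_lt hi]⟩
  obtain ⟨q, rfl⟩ := (Polynomial.mem_lifts _).1 hlift
  obtain ⟨x, hx⟩ := IsAlgClosed.exists_root q (by
    rw [← Polynomial.degree_map q (toKOmega L N)]
    exact hirr.degree_pos.ne')
  exact ⟨toKOmega L N x, by rw [Polynomial.eval_map_apply, hx.eq_zero, map_zero]⟩

end TowerPlace

theorem IsPlace.inv {K L : Type*} [Field K] [Field L] {S : K → L → Prop}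
    (hS : IsPlace S)
    {x : K} {c : L} (h : S x c) (hc : c ≠ 0) : x ≠ 0 ∧ S x⁻¹ c⁻¹ := by
  have hx : x ≠ 0 := by
    rintro rfl
    exact hc (hS.unique h hS.zero)
  rcases hS.finite_or_inv x⁻¹ with ⟨e, he⟩ | h0
  · have h1 := hS.mul h he
    rw [mul_inv_cancel₀ hx] at h1
    rw [← eq_inv_of_mul_eq_one_right (hS.unique h1 hS.one)]
    exact ⟨hx, he⟩
  · rw [inv_inv] at h0
    exact absurd (hS.unique h h0) hc

/-! ### The valuation ring of the place -/

section PlaceRing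

variable {K L : Type*} [Field K] [Field L] [Algebra L K] {S : K → L → Prop}

/-- The valuation ring of a place that is the identity on the constants `L`. -/
def IsPlace.ring (hS : IsPlace S) (hc : ∀ c, S (algebraMap L K c) c) : Subalgebra L K where
  carrier := {x | ∃ c, S x c}
  mul_mem' := fun ⟨_, h⟩ ⟨_, h'⟩ => ⟨_, hS.mul h h'⟩
  add_mem' := fun ⟨_, h⟩ ⟨_, h'⟩ => ⟨_, hS.add h h'⟩
  algebraMap_mem' c := ⟨c, hc c⟩

/-- The residue map of the valuation ring of a place. -/
noncomputable def IsPlace.residue (hS : IsPlace S) (hc : ∀ c, S (algebraMap L K c) c) :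
    hS.ring hc →ₐ[L] L where
  toFun x := x.2.choose
  map_zero' := hS.unique (Exists.choose_spec _) hS.zero
  map_one' := hS.unique (Exists.choose_spec _) hS.one
  map_add' x y := hS.unique (Exists.choose_spec _) (hS.add x.2.choose_spec y.2.choose_spec)
  map_mul' x y := hS.unique (Exists.choose_spec _) (hS.mul x.2.choose_spec y.2.choose_spec)
  commutes' c := hS.unique (Exists.choose_spec _) (hc c)

variable (hS : IsPlace S) (hc : ∀ c, S (algebraMap L K c) c)

theorem IsPlace.spec_residue (x : hS.ring hc) : S x (hS.residue hc x) :=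
  x.2.choose_spec

theorem IsPlace.residue_eq_iff {x : hS.ring hc} {c : L} : hS.residue hc x = c ↔ S x c :=
  ⟨fun h => h ▸ hS.spec_residue hc x, hS.unique (hS.spec_residue hc x)⟩

theorem IsPlace.isUnit_of_residue_ne_zero {x : hS.ring hc} (hx : hS.residue hc x ≠ 0) :
    IsUnit x :=
  have h := hS.inv (hS.spec_residue hc x) hx
  IsUnit.of_mul_eq_one ⟨(x : K)⁻¹, _, h.2⟩ (Subtype.ext (mul_inv_cancel₀ h.1))

/-- The valuation ring of a place as a `ValuationSubring`. -/
def IsPlace.valuationSubring : ValuationSubring K :=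
  { (hS.ring hc).toSubring with
    mem_or_inv_mem' := fun x => (hS.finite_or_inv x).imp id fun h => ⟨0, h⟩ }

theorem IsPlace.isIntegrallyClosedIn : IsIntegrallyClosedIn (hS.ring hc) K := by
  refine isIntegrallyClosedIn_iff.2 ⟨Subtype.val_injective, fun {x} hx => ?_⟩
  have hx' : IsIntegral (hS.valuationSubring hc) x := hx
  obtain ⟨y, hy⟩ := IsIntegrallyClosed.isIntegral_iff.1 hx'
  exact ⟨y, hy⟩

/-- Homogeneous coordinates can be scaled so that their residues exist and do not all vanish. -/
theorem IsPlace.exists_smul_spec (hS : IsPlace S) (hc : ∀ c, S (algebraMap L K c) c)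
    {ι : Type*} [Finite ι] {v : ι → K} (hv : v ≠ 0) :
    ∃ (s : K) (g : ι → L), s ≠ 0 ∧ g ≠ 0 ∧ ∀ j, S (s * v j) (g j) := by
  obtain ⟨i₀, hi₀⟩ := Function.ne_iff.1 hv
  let w := (hS.valuationSubring hc).valuation
  have : Nonempty ι := ⟨i₀⟩
  obtain ⟨i, hi⟩ := Finite.exists_max fun j => w (v j)
  have hvi : v i ≠ 0 := fun h => by
    have := hi i₀
    rw [h, map_zero, le_zero_iff, map_eq_zero] at this
    exact hi₀ this
  have hmem : ∀ j, ∃ c, S ((v i)⁻¹ * v j) c := fun j => by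
    have h1 : (v i)⁻¹ * v j ∈ hS.valuationSubring hc := by
      rw [← ValuationSubring.valuation_le_one_iff, map_mul, map_inv₀]
      exact inv_mul_le_one_of_le₀ (hi j) zero_le
    exact h1
  choose g hg using hmem
  refine ⟨(v i)⁻¹, g, inv_ne_zero hvi, fun h => ?_, hg⟩
  have h1 := hg i
  rw [inv_mul_cancel₀ hvi, h] at h1
  exact one_ne_zero (hS.unique hS.one h1)

end PlaceRing

/-! ### Affine charts and multihomogeneous polynomials -/

section Charts

open MvPolynomial

variable {L : Type u} [Field L] {n : ℕ} {ι : Type} {K : Type u} [Field K] [Algebra L K]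

/-- The point of a product of projective spaces with homogeneous coordinates `v`. -/
abbrev pointOf (v : ι × Fin (n + 1) → K) (hv : ∀ i, (fun j => v (i, j)) ≠ 0) :
    ι → PSpace K n :=
  fun i => Projectivization.mk K (fun j => v (i, j)) (hv i)

theorem coord_ne_zero_of_eq_one {v : ι × Fin (n + 1) → K} {c : ι → Fin (n + 1)}
    (hv : ∀ i, v (i, c i) = 1) (i : ι) : (fun j => v (i, j)) ≠ 0 := fun h => by
  have := congrFun h (c i)
  rw [hv] at this
  exact one_ne_zero this

theorem aeval_mul_of_isWeightedHomogeneous {f : MvPolynomial (ι × Fin (n + 1)) L} {d : ι →₀ ℕ}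
    (hf : f.IsWeightedHomogeneous (fun p => Finsupp.single p.1 1) d) (μ : ι → K)
    (v : ι × Fin (n + 1) → K) :
    aeval (fun p => μ p.1 * v p) f = (d.prod fun i k => μ i ^ k) * aeval v f := by
  rw [aeval_def, aeval_def, eval₂_eq, eval₂_eq, Finset.mul_sum]
  refine Finset.sum_congr rfl fun s hs => ?_
  have hd : Finsupp.weight (fun p : ι × Fin (n + 1) => Finsupp.single p.1 1) s = d :=
    hf (mem_support_iff.1 hs)
  have hprod : ∏ p ∈ s.support, μ p.1 ^ s p = d.prod fun i k => μ i ^ k := by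
    rw [← hd, Finsupp.weight_apply, Finsupp.sum, ← Finsupp.prod_finsetSum_index]
    · refine Finset.prod_congr rfl fun p _ => ?_
      simp
    · simp
    · intro i a b
      exact pow_add _ _ _
  simp only [mul_pow, Finset.prod_mul_distrib, hprod]
  ring

theorem vanishesAt_pointOf {f : MvPolynomial (ι × Fin (n + 1)) L} (hf : IsMultihomogeneous f)
    (v : ι × Fin (n + 1) → K) (hv : ∀ i, (fun j => v (i, j)) ≠ 0) :
    VanishesAt f (pointOf v hv) ↔ aeval v f = 0 := by
  obtain ⟨d, hd⟩ := hf
  choose μ hμ using fun i => Projectivization.exists_smul_eq_mk_rep K (fun j => v (i, j)) (hv i)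
  have h : (fun p : ι × Fin (n + 1) => (pointOf v hv p.1).rep p.2) =
      fun p => (μ p.1 : K) * v p := funext fun p => (congrFun (hμ p.1) p.2).symm
  rw [VanishesAt, h, aeval_mul_of_isWeightedHomogeneous hd (fun i => (μ i : K)), mul_eq_zero,
    or_iff_right]
  exact Finset.prod_ne_zero_iff.2 fun i _ => pow_ne_zero _ (μ i).ne_zero

theorem vanishesAt_ext {f : MvPolynomial (ι × Fin (n + 1)) L} (hf : IsMultihomogeneous f)
    (y : ι → PSpace L n) :
    VanishesAt f (fun i => PSpace.ext (algebraMap L K) (y i)) ↔ VanishesAt f y := by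
  have h : (fun i => PSpace.ext (algebraMap L K) (y i)) =
      pointOf (fun p => algebraMap L K ((y p.1).rep p.2))
        (fun i => comp_ne_zero (algebraMap L K) (y i).rep_nonzero) := by
    funext i
    conv_lhs => rw [← (y i).mk_rep, PSpace.ext_mk]
  rw [h, vanishesAt_pointOf hf, VanishesAt]
  change aeval (algebraMap L K ∘ fun p : ι × Fin (n + 1) => (y p.1).rep p.2) f = 0 ↔ _
  rw [aeval_algebraMap_apply, map_eq_zero_iff _ (algebraMap L K).injective]

theorem exists_normalised {y : ι → PSpace K n} {c : ι → Fin (n + 1)}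
    (h : ∀ i, (y i).rep (c i) ≠ 0) : ∃ (u : ι × Fin (n + 1) → K) (hu : ∀ i, u (i, c i) = 1),
      pointOf u (coord_ne_zero_of_eq_one hu) = y := by
  refine ⟨fun p => ((y p.1).rep (c p.1))⁻¹ * (y p.1).rep p.2,
    fun i => inv_mul_cancel₀ (h i), funext fun i => ?_⟩
  conv_rhs => rw [← (y i).mk_rep]
  rw [Projectivization.mk_eq_mk_iff']
  exact ⟨((y i).rep (c i))⁻¹, rfl⟩

theorem normalised_unique {u v : ι × Fin (n + 1) → K} {c : ι → Fin (n + 1)}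
    (hu : ∀ i, u (i, c i) = 1) (hv : ∀ i, v (i, c i) = 1)
    (h : pointOf u (coord_ne_zero_of_eq_one hu) = pointOf v (coord_ne_zero_of_eq_one hv)) :
    u = v := by
  funext ⟨i, j⟩
  obtain ⟨s, hs⟩ := (Projectivization.mk_eq_mk_iff' K _ _ _ _).1 (congrFun h i)
  have h1 : s * v (i, c i) = u (i, c i) := congrFun hs (c i)
  rw [hu, hv, mul_one] at h1
  have h2 : s * v (i, j) = u (i, j) := congrFun hs j
  rw [← h2, h1, one_mul]

theorem mem_chart_iff {W : Set (ι → PSpace L n)} {c : ι → Fin (n + 1)}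
    {u : ι × Fin (n + 1) → L} : u ∈ chart W c ↔
      ∃ hu : ∀ i, u (i, c i) = 1, pointOf u (coord_ne_zero_of_eq_one hu) ∈ W :=
  ⟨fun ⟨hu, _, h⟩ => ⟨hu, h⟩, fun ⟨hu, h⟩ => ⟨hu, _, h⟩⟩

theorem isMultihomogeneous_X (p : ι × Fin (n + 1)) :
    IsMultihomogeneous (X p : MvPolynomial (ι × Fin (n + 1)) L) :=
  ⟨_, isWeightedHomogeneous_X _ _ _⟩

theorem IsMultihomogeneous.prod {τ : Type*} (s : Finset τ)
    {f : τ → MvPolynomial (ι × Fin (n + 1)) L} (h : ∀ i ∈ s, IsMultihomogeneous (f i)) :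
    IsMultihomogeneous (∏ i ∈ s, f i) := by
  classical
  induction s using Finset.induction_on with
  | empty => exact ⟨0, by simpa using isWeightedHomogeneous_one _ _⟩
  | insert a s ha ih =>
    rw [Finset.prod_insert ha]
    obtain ⟨d, hd⟩ := h a (Finset.mem_insert_self a s)
    obtain ⟨e, he⟩ := ih fun i hi => h i (Finset.mem_insert_of_mem hi)
    exact ⟨_, hd.mul he⟩

theorem IsMultihomogeneous.rename {κ : Type} {φ : ι → κ}
    {f : MvPolynomial (ι × Fin (n + 1)) L} (hf : IsMultihomogeneous f) :
    IsMultihomogeneous (MvPolynomial.rename (Prod.map φ id) f :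
      MvPolynomial (κ × Fin (n + 1)) L) := by
  classical
  obtain ⟨d, hd⟩ := hf
  refine ⟨d.mapDomain φ, ?_⟩
  rw [f.as_sum, map_sum]
  refine IsWeightedHomogeneous.sum _ _ _ fun s hs => ?_
  rw [rename_monomial]
  refine isWeightedHomogeneous_monomial _ _ _ ?_
  rw [← hd (mem_support_iff.1 hs), Finsupp.weight_apply, Finsupp.weight_apply,
    Finsupp.sum_mapDomain_index (by simp) (fun _ _ _ => add_smul _ _ _)]
  simp only [Finsupp.sum, Finsupp.mapDomain_finsetSum]
  refine Finset.sum_congr rfl fun p _ => ?_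
  simp [Finsupp.mapDomain_single]

theorem isZariskiClosed_vanishesAt {f : MvPolynomial (ι × Fin (n + 1)) L}
    (hf : IsMultihomogeneous f) : IsZariskiClosed {y : ι → PSpace L n | VanishesAt f y} :=
  ⟨{f}, by simpa using hf, by simp⟩

variable (K) in
/-- Multihomogenisation: a polynomial on the chart `c` agrees on the chart with a multihomogeneous
polynomial `g` that vanishes off the chart. So `g` vanishes on `W` as soon as `f` vanishes on the
part of `W` in the chart. -/
theorem exists_multihomogenisation [Finite ι] (c : ι → Fin (n + 1))
    (f : MvPolynomial (ι × Fin (n + 1)) L) :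
    ∃ g : MvPolynomial (ι × Fin (n + 1)) L, IsMultihomogeneous g ∧
      (∀ v : ι × Fin (n + 1) → K, (∀ i, v (i, c i) = 1) → aeval v g = aeval v f) ∧
      ∀ W : Set (ι → PSpace L n), (∀ y ∈ W, VanishesAt g y) ↔
        f ∈ vanishingIdeal L (chart W c) := by
  classical
  have := Fintype.ofFinite ι
  let w : ι × Fin (n + 1) → ι →₀ ℕ := fun p => Finsupp.single p.1 1
  let N : ℕ := f.support.sup fun s => Finset.univ.sup fun i => Finsupp.weight w s i
  have hN : ∀ s ∈ f.support, ∀ i, Finsupp.weight w s i ≤ N := fun s hs i =>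
    (Finset.le_sup (f := fun i => Finsupp.weight w s i) (Finset.mem_univ i)).trans
      (Finset.le_sup (f := fun s => Finset.univ.sup fun i => Finsupp.weight w s i) hs)
  -- The degree `N + 1` in each block, instead of `N`, makes `g` vanish off the chart.
  let g : MvPolynomial (ι × Fin (n + 1)) L := ∑ s ∈ f.support,
    monomial s (f.coeff s) * ∏ i, X (i, c i) ^ (N + 1 - Finsupp.weight w s i)
  have hg : IsMultihomogeneous g := by
    refine ⟨Finsupp.equivFunOnFinite.symm fun _ => N + 1, ?_⟩
    refine IsWeightedHomogeneous.sum _ _ _ fun s hs => ?_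
    have h1 := (isWeightedHomogeneous_monomial w s (f.coeff s) rfl).mul
      (IsWeightedHomogeneous.prod (w := w) Finset.univ
        (fun i => (X (i, c i) : MvPolynomial (ι × Fin (n + 1)) L) ^
          (N + 1 - Finsupp.weight w s i))
        (fun i => (N + 1 - Finsupp.weight w s i) • w (i, c i)) fun i _ =>
          (isWeightedHomogeneous_X L w (i, c i)).pow _)
    convert! h1 using 1
    ext i
    have := hN s hs i
    have hi : ∀ k, ((N + 1 - Finsupp.weight w s k) • w (k, c k)) i =
        if k = i then N + 1 - Finsupp.weight w s k else 0 := fun k => by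
      rw [Finsupp.smul_apply, smul_eq_mul, Finsupp.single_apply, mul_ite, mul_one, mul_zero]
    rw [Finsupp.add_apply, Finsupp.finsetSum_apply, Finset.sum_congr rfl fun k _ => hi k,
      Finset.sum_ite_eq' _ _ _, if_pos (Finset.mem_univ i)]
    change N + 1 = _
    omega
  have hone : ∀ {E : Type u} [Field E] [Algebra L E] (v : ι × Fin (n + 1) → E),
      (∀ i, v (i, c i) = 1) → aeval v g = aeval v f := by
    intro E _ _ v hv
    conv_rhs => rw [f.as_sum, map_sum]
    simp [g, hv]
  have hzero : ∀ (v : ι × Fin (n + 1) → L) (i), v (i, c i) = 0 → aeval v g = 0 := by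
    intro v i hv
    rw [map_sum]
    refine Finset.sum_eq_zero fun s hs => ?_
    have := hN s hs i
    rw [map_mul, map_prod, Finset.prod_eq_zero (Finset.mem_univ i), mul_zero]
    rw [map_pow, aeval_X, hv, zero_pow (by omega)]
  refine ⟨g, hg, fun v hv => hone v hv, fun W => ⟨fun h => ?_, fun h y hy => ?_⟩⟩
  · rw [mem_vanishingIdeal_iff]
    intro u hu
    obtain ⟨hu1, huW⟩ := mem_chart_iff.1 hu
    rw [← hone u hu1]
    exact (vanishesAt_pointOf hg _ _).1 (h _ huW)
  · by_cases hc : ∀ i, (y i).rep (c i) ≠ 0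
    · obtain ⟨u, hu, rfl⟩ := exists_normalised hc
      rw [vanishesAt_pointOf hg, hone u hu]
      exact mem_vanishingIdeal_iff.1 h u (mem_chart_iff.2 ⟨hu, hy⟩)
    · push Not at hc
      obtain ⟨i, hi⟩ := hc
      exact hzero _ i hi

variable {c : ι → Fin (n + 1)} {W : Set (ι → PSpace L n)}

theorem aeval_eq_zero_of_mem_points [Finite ι] {v : ι × Fin (n + 1) → K}
    (hv : ∀ i, v (i, c i) = 1) (h : pointOf v (coord_ne_zero_of_eq_one hv) ∈ points K W)
    {f : MvPolynomial (ι × Fin (n + 1)) L} (hf : f ∈ vanishingIdeal L (chart W c)) :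
    aeval v f = 0 := by
  obtain ⟨g, hg, hgv, hgW⟩ := exists_multihomogenisation K c f
  rw [← hgv v hv]
  exact (vanishesAt_pointOf hg _ _).1 (h g hg ((hgW W).2 hf))

theorem pointOf_mem_points {v : ι × Fin (n + 1) → K} (hv : ∀ i, (fun j => v (i, j)) ≠ 0)
    (h : ∀ f ∈ vanishingIdeal L (chart W c), aeval v f = 0) : pointOf v hv ∈ points K W := by
  intro g hg hgW
  rw [vanishesAt_pointOf hg]
  refine h g (mem_vanishingIdeal_iff.2 fun u hu => ?_)
  obtain ⟨hu1, huW⟩ := mem_chart_iff.1 hu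
  exact (vanishesAt_pointOf hg _ _).1 (hgW _ huW)

theorem mem_of_mem_points (hW : IsZariskiClosed W) {y : ι → PSpace L n} (hy : y ∈ points L W) :
    y ∈ W := by
  obtain ⟨S, hS, rfl⟩ := hW
  exact fun f hf => hy f (hS f hf) fun z hz => hz f hf

/-- A polynomial on a chart of `W` that vanishes at a generic point of `W` vanishes on `W`. By the
Nullstellensatz the generic point lies on every subvariety cut out by one equation that it
satisfies. -/
theorem mem_vanishingIdeal_of_isGeneric [IsAlgClosed L] [Finite ι] {v : ι × Fin (n + 1) → K}
    (hv : ∀ i, v (i, c i) = 1) (hgen : IsGeneric W (pointOf v (coord_ne_zero_of_eq_one hv)))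
    {f : MvPolynomial (ι × Fin (n + 1)) L} (hf : aeval v f = 0) :
    f ∈ vanishingIdeal L (chart W c) := by
  classical
  have := Fintype.ofFinite ι
  obtain ⟨g, hg, hgv, hgW⟩ := exists_multihomogenisation K c f
  rw [← hgv v hv] at hf
  rw [← hgW W]
  have hmem : pointOf v (coord_ne_zero_of_eq_one hv) ∈
      points K {y : ι → PSpace L n | VanishesAt g y} := by
    intro p hp hpg
    rw [vanishesAt_pointOf hp]
    -- Zeros of `g` that are not coordinates of a point are killed by the extra factor.
    have hrad : p * ∏ i, X (i, c i) ∈ (Ideal.span {g}).radical := by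
      rw [← vanishingIdeal_zeroLocus_eq_radical (K := L), mem_vanishingIdeal_iff]
      intro u hu
      have hgu : aeval u g = 0 := (mem_zeroLocus_iff.1 hu) g (Ideal.mem_span_singleton_self g)
      rw [map_mul, map_prod]
      by_cases hc : ∃ i, u (i, c i) = 0
      · obtain ⟨i, hi⟩ := hc
        rw [Finset.prod_eq_zero (Finset.mem_univ i) (by rw [aeval_X, hi]), mul_zero]
      · push Not at hc
        have hu0 : ∀ i, (fun j => u (i, j)) ≠ 0 := fun i h => hc i (congrFun h (c i))
        rw [(vanishesAt_pointOf hp u hu0).1 (hpg _ ((vanishesAt_pointOf hg u hu0).2 hgu)),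
          zero_mul]
    obtain ⟨k, hk⟩ := hrad
    obtain ⟨q, hq⟩ := Ideal.mem_span_singleton'.1 hk
    have h1 := congrArg (aeval v) hq
    rw [map_mul, hf, mul_zero, map_pow, map_mul, map_prod] at h1
    simp only [aeval_X, hv, Finset.prod_const_one, mul_one] at h1
    exact eq_zero_of_pow_eq_zero h1.symm
  intro y hy
  have hyK : (fun i => PSpace.ext (algebraMap L K) (y i)) ∈ points K W := fun p hp hpW =>
    (vanishesAt_ext hp y).2 (hpW y hy)
  rw [← hgen] at hyK
  exact (vanishesAt_ext hg y).1
    (hyK _ (isZariskiClosed_vanishesAt hg) hmem g hg fun _ h => h)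

theorem IsIrreducibleSet.forall_vanishesAt (hW : IsIrreducibleSet W)
    {p q : MvPolynomial (ι × Fin (n + 1)) L} (hp : IsMultihomogeneous p)
    (hq : IsMultihomogeneous q) (h : ∀ y ∈ W, VanishesAt p y ∨ VanishesAt q y) :
    (∀ y ∈ W, VanishesAt p y) ∨ ∀ y ∈ W, VanishesAt q y :=
  hW.2 _ _ (isZariskiClosed_vanishesAt hp) (isZariskiClosed_vanishesAt hq) h

/-- The chart ring of an irreducible variety is a domain. -/
theorem isDomain_chartRing [Finite ι] (hW : IsIrreducibleSet W) (hc : (chart W c).Nonempty) :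
    IsDomain (ChartRing W c) := by
  rw [Ideal.Quotient.isDomain_iff_prime]
  refine ⟨fun h => ?_, fun {f₁ f₂} h => ?_⟩
  · obtain ⟨u, hu⟩ := hc
    have h1 := mem_vanishingIdeal_iff.1
      (h ▸ Submodule.mem_top : (1 : MvPolynomial _ L) ∈ vanishingIdeal L (chart W c)) u hu
    rw [map_one] at h1
    exact one_ne_zero h1
  · obtain ⟨g₁, hg₁, -, hW₁⟩ := exists_multihomogenisation L c f₁
    obtain ⟨g₂, hg₂, -, hW₂⟩ := exists_multihomogenisation L c f₂
    rw [← hW₁, ← hW₂]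
    refine hW.forall_vanishesAt hg₁ hg₂ fun y hy => ?_
    have e₁ := hW₁ {y}
    have e₂ := hW₂ {y}
    simp only [Set.mem_singleton_iff, forall_eq, mem_vanishingIdeal_iff] at e₁ e₂
    rw [e₁, e₂]
    by_contra! hcon
    obtain ⟨⟨u, hu, hu'⟩, ⟨u', hu₂, hu₂'⟩⟩ := hcon
    obtain ⟨hu1, huy⟩ := mem_chart_iff.1 hu
    obtain ⟨hu1', huy'⟩ := mem_chart_iff.1 hu₂
    obtain rfl := normalised_unique hu1 hu1' (huy.trans huy'.symm)
    have := mem_vanishingIdeal_iff.1 h u (mem_chart_iff.2 ⟨hu1, by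
      rw [Set.mem_singleton_iff.1 huy]; exact hy⟩)
    rw [map_mul, mul_eq_zero] at this
    exact this.elim hu' hu₂'

/-- Evaluation at the coordinates of a point of a chart, with values in an `L`-algebra. -/
noncomputable def chartEval {R : Type*} [CommRing R] [Algebra L R] (v : ι × Fin (n + 1) → R)
    (h : ∀ f ∈ vanishingIdeal L (chart W c), aeval v f = 0) : ChartRing W c →ₐ[L] R :=
  Ideal.Quotient.liftₐ _ (aeval v) h

/-- The coordinates of a point of the chart ring with values in an `L`-algebra. -/
noncomputable def chartCoord {R : Type*} [CommRing R] [Algebra L R] (χ : ChartRing W c →ₐ[L] R)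
    (p : ι × Fin (n + 1)) : R :=
  χ (Ideal.Quotient.mk _ (X p))

section Coord

variable {R : Type*} [CommRing R] [Algebra L R] (χ : ChartRing W c →ₐ[L] R)

theorem apply_mk_eq_aeval_chartCoord (f : MvPolynomial (ι × Fin (n + 1)) L) :
    χ (Ideal.Quotient.mk _ f) = aeval (chartCoord χ) f := by
  have : χ.comp (Ideal.Quotient.mkₐ L _) = aeval (chartCoord χ) := by
    refine algHom_ext fun p => ?_
    rw [aeval_X]
    rfl
  exact DFunLike.congr_fun this f

theorem aeval_chartCoord_eq_zero {f : MvPolynomial (ι × Fin (n + 1)) L}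
    (hf : f ∈ vanishingIdeal L (chart W c)) : aeval (chartCoord χ) f = 0 := by
  rw [← apply_mk_eq_aeval_chartCoord, Ideal.Quotient.eq_zero_iff_mem.2 hf, map_zero]

theorem chartCoord_eq_one (i : ι) : chartCoord χ (i, c i) = 1 := by
  have h : (X (i, c i) - 1 : MvPolynomial (ι × Fin (n + 1)) L) ∈
      vanishingIdeal L (chart W c) := by
    refine mem_vanishingIdeal_iff.2 fun u hu => ?_
    rw [map_sub, aeval_X, map_one, hu.1 i, sub_self]
  have := aeval_chartCoord_eq_zero χ h
  rwa [map_sub, aeval_X, map_one, sub_eq_zero] at this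

theorem algHom_ext_chartCoord {χ χ' : ChartRing W c →ₐ[L] R} (h : chartCoord χ = chartCoord χ') :
    χ = χ' := by
  ext x
  obtain ⟨f, rfl⟩ := Ideal.Quotient.mk_surjective x
  rw [apply_mk_eq_aeval_chartCoord, apply_mk_eq_aeval_chartCoord, h]

end Coord

theorem chartCoord_mem_chart (hW : IsZariskiClosed W) (χ : ChartRing W c →ₐ[L] L) :
    chartCoord χ ∈ chart W c :=
  mem_chart_iff.2 ⟨chartCoord_eq_one χ, mem_of_mem_points hW
    (pointOf_mem_points _ fun _ hf => aeval_chartCoord_eq_zero χ hf)⟩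

end Charts

/-! ### Projections of charts and infinitesimal neighbourhoods -/

section Projection

open MvPolynomial

variable {L : Type u} [Field L] {n : ℕ} {ι κ : Type} {D : Set (ι → PSpace L n)}
  {F : Set (ι ⊕ κ → PSpace L n)} {c : ι → Fin (n + 1)} {d : κ → Fin (n + 1)}

theorem comp_inl_mem_chart (hFD : ∀ x ∈ F, x ∘ Sum.inl ∈ D) {u : (ι ⊕ κ) × Fin (n + 1) → L}
    (hu : u ∈ chart F (Sum.elim c d)) : u ∘ Prod.map Sum.inl id ∈ chart D c := by
  obtain ⟨hu1, huF⟩ := mem_chart_iff.1 hu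
  exact mem_chart_iff.2 ⟨fun i => hu1 (Sum.inl i), hFD _ huF⟩

theorem rename_mem_vanishingIdeal (hFD : ∀ x ∈ F, x ∘ Sum.inl ∈ D)
    {f : MvPolynomial (ι × Fin (n + 1)) L} (hf : f ∈ vanishingIdeal L (chart D c)) :
    rename (Prod.map Sum.inl id) f ∈ vanishingIdeal L (chart F (Sum.elim c d)) := by
  refine mem_vanishingIdeal_iff.2 fun u hu => ?_
  rw [aeval_rename]
  exact mem_vanishingIdeal_iff.1 hf _ (comp_inl_mem_chart hFD hu)

/-- The map on chart rings induced by the projection `F → D`. -/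
noncomputable def chartProj (c : ι → Fin (n + 1)) (d : κ → Fin (n + 1))
    (hFD : ∀ x ∈ F, x ∘ Sum.inl ∈ D) : ChartRing D c →ₐ[L] ChartRing F (Sum.elim c d) :=
  Ideal.Quotient.liftₐ _ ((Ideal.Quotient.mkₐ L _).comp (rename (Prod.map Sum.inl id)))
    fun _ hf => Ideal.Quotient.eq_zero_iff_mem.2 (rename_mem_vanishingIdeal hFD hf)

theorem chartProj_mk (hFD : ∀ x ∈ F, x ∘ Sum.inl ∈ D) (f : MvPolynomial (ι × Fin (n + 1)) L) :
    chartProj c d hFD (Ideal.Quotient.mk _ f) =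
      Ideal.Quotient.mk _ (rename (Prod.map Sum.inl id) f) :=
  rfl

/-- As `F` is irreducible, a nonempty chart of `F` is dense in `F`, and so dominates `D`. -/
theorem chartProj_injective [Finite ι] [Finite κ] (hFD : ∀ x ∈ F, x ∘ Sum.inl ∈ D)
    (hF : IsIrreducibleSet F) (hsurj : ∀ a ∈ D, ∃ b, Sum.elim a b ∈ F)
    (hne : (chart F (Sum.elim c d)).Nonempty) : Function.Injective (chartProj c d hFD) := by
  have := Fintype.ofFinite κ
  rw [injective_iff_map_eq_zero]
  intro x hx
  obtain ⟨f, rfl⟩ := Ideal.Quotient.mk_surjective x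
  rw [chartProj_mk, Ideal.Quotient.eq_zero_iff_mem] at hx
  rw [Ideal.Quotient.eq_zero_iff_mem]
  obtain ⟨g, hg, -, hgW⟩ := exists_multihomogenisation L c f
  rw [← hgW]
  let g' : MvPolynomial ((ι ⊕ κ) × Fin (n + 1)) L := rename (Prod.map Sum.inl id) g
  let p : MvPolynomial ((ι ⊕ κ) × Fin (n + 1)) L := ∏ j, X (Sum.inr j, d j)
  have hg' : ∀ y : ι ⊕ κ → PSpace L n, VanishesAt g' y ↔ VanishesAt g (y ∘ Sum.inl) := fun y => by
    rw [VanishesAt, aeval_rename]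
    rfl
  have hp : ∀ y : ι ⊕ κ → PSpace L n, VanishesAt p y ↔ ∃ j, (y (Sum.inr j)).rep (d j) = 0 :=
    fun y => by
      rw [VanishesAt, map_prod, Finset.prod_eq_zero_iff]
      simp
  have hpm : IsMultihomogeneous p := .prod _ fun j _ => isMultihomogeneous_X _
  rcases hF.forall_vanishesAt (p := g') (q := p) hg.rename hpm (fun y hy => by
      rw [hg', hp]
      by_contra! hcon
      obtain ⟨hgy, hpy⟩ := hcon
      have e := hgW {y ∘ Sum.inl}
      simp only [Set.mem_singleton_iff, forall_eq, mem_vanishingIdeal_iff] at e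
      rw [e] at hgy
      push Not at hgy
      obtain ⟨u, hu, hfu⟩ := hgy
      obtain ⟨hu1, huy⟩ := mem_chart_iff.1 hu
      obtain ⟨v, hv1, hvy⟩ := exists_normalised (y := y ∘ Sum.inr) hpy
      let w : (ι ⊕ κ) × Fin (n + 1) → L :=
        fun p => Sum.elim (fun i => u (i, p.2)) (fun j => v (j, p.2)) p.1
      refine hfu ?_
      have hw : w ∈ chart F (Sum.elim c d) := by
        refine mem_chart_iff.2 ⟨?_, ?_⟩
        · rintro (i | j)
          · exact hu1 i
          · exact hv1 j
        · convert hy using 1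
          funext i
          rcases i with i | j
          · exact congrFun huy i
          · exact congrFun hvy j
      have := mem_vanishingIdeal_iff.1 hx w hw
      rwa [aeval_rename] at this) with h | h
  · intro a ha
    obtain ⟨b, hb⟩ := hsurj a ha
    have h1 := (hg' (Sum.elim a b)).1 (h _ hb)
    rwa [Sum.elim_comp_inl] at h1
  · obtain ⟨u, hu⟩ := hne
    obtain ⟨hu1, huF⟩ := mem_chart_iff.1 hu
    have h1 := h _ huF
    rw [vanishesAt_pointOf hpm, map_prod, Finset.prod_eq_zero_iff] at h1
    obtain ⟨j, -, hj⟩ := h1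
    rw [aeval_X] at hj
    exact absurd ((hu1 (Sum.inr j)).symm.trans hj) one_ne_zero

/-- The points of a chart of `F` over a point of `D` are finite in number if the fibre is. -/
theorem finite_algHom_chartProj (hFD : ∀ x ∈ F, x ∘ Sum.inl ∈ D) (hF : IsZariskiClosed F)
    (hfin : ∀ a ∈ D, {b : κ → PSpace L n | Sum.elim a b ∈ F}.Finite)
    (χ : ChartRing F (Sum.elim c d) →ₐ[L] L) :
    {χ' : ChartRing F (Sum.elim c d) →ₐ[L] L |
      ∀ x, χ' (chartProj c d hFD x) = χ (chartProj c d hFD x)}.Finite := by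
  obtain ⟨h1, hmem⟩ := mem_chart_iff.1 (chartCoord_mem_chart hF χ)
  let point (χ' : ChartRing F (Sum.elim c d) →ₐ[L] L) : ι ⊕ κ → PSpace L n :=
    pointOf (chartCoord χ') (coord_ne_zero_of_eq_one (chartCoord_eq_one χ'))
  have hinl : ∀ χ' : ChartRing F (Sum.elim c d) →ₐ[L] L,
      (∀ x, χ' (chartProj c d hFD x) = χ (chartProj c d hFD x)) →
        point χ' ∘ Sum.inl = point χ ∘ Sum.inl := by
    intro χ' hχ'
    have hcoord : ∀ i j, chartCoord χ' (Sum.inl i, j) = chartCoord χ (Sum.inl i, j) := by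
      intro i j
      have := hχ' (Ideal.Quotient.mk _ (X (i, j)))
      rwa [chartProj_mk, rename_X] at this
    funext i
    simp only [point, Function.comp_apply, pointOf, hcoord]
  refine Set.Finite.of_finite_image (f := fun χ' => point χ' ∘ Sum.inr)
    ((hfin _ (hFD _ hmem)).subset ?_) ?_
  · rintro _ ⟨χ', hχ', rfl⟩
    change Sum.elim (point χ ∘ Sum.inl) (point χ' ∘ Sum.inr) ∈ F
    rw [← hinl χ' hχ', Sum.elim_comp_inl_inr]
    exact (mem_chart_iff.1 (chartCoord_mem_chart hF χ')).2
  · intro χ₁ h₁ χ₂ h₂ h12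
    refine algHom_ext_chartCoord (normalised_unique (chartCoord_eq_one χ₁)
      (chartCoord_eq_one χ₂) ?_)
    change point χ₁ = point χ₂
    rw [← Sum.elim_comp_inl_inr (point χ₁), ← Sum.elim_comp_inl_inr (point χ₂), hinl χ₁ h₁,
      hinl χ₂ h₂]
    exact congrArg _ h12

end Projection

section Infinitesimal

variable {L : Type u} [Field L] [IsAlgClosed L] {n : ℕ} {ι : Type}

/-- A point that `Π_ω` maps into an affine chart has coordinates in this chart, and they specialise
to those of its image. -/
theorem exists_normalised_specialisation {c : ι → Fin (n + 1)} {u : ι × Fin (n + 1) → L}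
    (hu : ∀ i, u (i, c i) = 1) {y : ι → PSpace (KOmega L) n}
    (hy : ∀ i, specialisation (y i) = pointOf u (coord_ne_zero_of_eq_one hu) i) :
    ∃ (v : ι × Fin (n + 1) → KOmega L) (hv : ∀ i, v (i, c i) = 1),
      pointOf v (coord_ne_zero_of_eq_one hv) = y ∧ ∀ p, OmegaSpec (v p) (u p) := by
  have key : ∀ i, ∃ w : Fin (n + 1) → KOmega L, w (c i) = 1 ∧
      (∃ hw : w ≠ 0, Projectivization.mk _ w hw = y i) ∧ ∀ j, OmegaSpec (w j) (u (i, j)) := by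
    intro i
    obtain ⟨s, g, hs, hg, hsg⟩ :=
      isPlace_omegaSpec.exists_smul_spec omegaSpec_algebraMap (y i).rep_nonzero
    have hs0 : s • (y i).rep ≠ 0 := smul_ne_zero hs (y i).rep_nonzero
    have hmk : Projectivization.mk _ (s • (y i).rep) hs0 = y i := by
      conv_rhs => rw [← (y i).mk_rep]
      rw [Projectivization.mk_eq_mk_iff']
      exact ⟨s, rfl⟩
    have hspec := specialisation_mk hs0 hg hsg
    rw [hmk, hy i, eq_comm, Projectivization.mk_eq_mk_iff'] at hspec
    obtain ⟨t, ht⟩ := hspec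
    have ht' : ∀ j, t * u (i, j) = g j := fun j => congrFun ht j
    have htc : g (c i) = t := by rw [← ht', hu, mul_one]
    have ht0 : t ≠ 0 := by
      rintro rfl
      exact hg (funext fun j => by rw [← ht', zero_mul]; rfl)
    obtain ⟨hx0, hinv⟩ := isPlace_omegaSpec.inv (hsg (c i)) (htc ▸ ht0)
    have hw1 : (s * (y i).rep (c i))⁻¹ * (s * (y i).rep (c i)) = 1 := inv_mul_cancel₀ hx0
    refine ⟨fun j => (s * (y i).rep (c i))⁻¹ * (s * (y i).rep j), hw1,
      ⟨fun h => one_ne_zero (hw1.symm.trans (congrFun h (c i))), ?_⟩, fun j => ?_⟩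
    · exact ((Projectivization.mk_eq_mk_iff' _ _ _ _ _).2 ⟨_, rfl⟩).trans hmk
    · have := isPlace_omegaSpec.mul hinv (hsg j)
      rwa [htc, ← ht', inv_mul_cancel_left₀ ht0] at this
  choose w hw1 hw hspec using key
  refine ⟨fun p => w p.1 p.2, hw1, funext fun i => ?_, fun p => hspec p.1 p.2⟩
  exact (hw i).2

end Infinitesimal

end ZariskiSpec

open ZariskiSpec MvPolynomial in
theorem theorem3p3 {L : Type*} [Field L] [IsAlgClosed L] {n m k : ℕ}
    (V : Set (ZariskiSpec.PSpace L n)) (hV : ZariskiSpec.IsSmoothProjective V)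
    (D : Set (Fin m → ZariskiSpec.PSpace L n)) (hD : ZariskiSpec.IsZariskiClosed D)
    (hDV : D ⊆ ZariskiSpec.power V (Fin m)) (hDs : ZariskiSpec.IsSmoothVariety D)
    (F : Set (Fin m ⊕ Fin k → ZariskiSpec.PSpace L n)) (hF : ZariskiSpec.IsFiniteCover V D F)
    (hFi : ZariskiSpec.IsIrreducibleSet F)
    (a : Fin m → ZariskiSpec.PSpace L n) (b : Fin k → ZariskiSpec.PSpace L n)
    (hab : Sum.elim a b ∈ F)
    (a' : Fin m → ZariskiSpec.PSpace (ZariskiSpec.KOmega L) n)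
    (ha' : a' ∈ ZariskiSpec.infNbhd V a)
    (ha'D : a' ∈ ZariskiSpec.points (ZariskiSpec.KOmega L) D)
    (ha'gen : ZariskiSpec.IsGeneric D a') :
    ∃ b' ∈ ZariskiSpec.infNbhd V b,
      Sum.elim a' b' ∈ ZariskiSpec.points (ZariskiSpec.KOmega L) F := by
  have hFD : ∀ x ∈ F, x ∘ Sum.inl ∈ D := fun x hx => (hF.subset_prod x hx).1
  have haD : a ∈ D := hFD _ hab
  choose c hc using fun i => Function.ne_iff.1 (a i).rep_nonzero
  choose d hd using fun j => Function.ne_iff.1 (b j).rep_nonzero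
  obtain ⟨u, hu, hua⟩ := exists_normalised (y := Sum.elim a b) (c := Sum.elim c d) (by
    rintro (i | j)
    · exact hc i
    · exact hd j)
  have huF : u ∈ chart F (Sum.elim c d) := mem_chart_iff.2 ⟨hu, hua ▸ hab⟩
  -- The coordinates of `a'` specialise to those of `a`.
  obtain ⟨v, hv, rfl, hvu⟩ := exists_normalised_specialisation
    (u := u ∘ Prod.map Sum.inl id) (c := c) (y := a') (fun i => hu (Sum.inl i))
    (fun i => (ha'.2 i).trans (congrFun hua (Sum.inl i)).symm)
  let hS := isPlace_omegaSpec (L := L)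
  let O := hS.ring omegaSpec_algebraMap
  let ρ : O →ₐ[L] L := hS.residue omegaSpec_algebraMap
  have hint : IsIntegrallyClosedIn O (KOmega L) := hS.isIntegrallyClosedIn omegaSpec_algebraMap
  let vO : Fin m × Fin (n + 1) → O := fun p => ⟨v p, _, hvu p⟩
  have hvO : ∀ f, ((aeval vO f : O) : KOmega L) = aeval v f := fun f =>
    comp_aeval_apply vO O.val f
  let α : ChartRing D c →ₐ[L] O := chartEval vO fun f hf =>
    Subtype.ext ((hvO f).trans (aeval_eq_zero_of_mem_points hv ha'D hf))
  have hα : Function.Injective α := by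
    rw [injective_iff_map_eq_zero]
    intro x hx
    obtain ⟨f, rfl⟩ := Ideal.Quotient.mk_surjective x
    refine Ideal.Quotient.eq_zero_iff_mem.2 (mem_vanishingIdeal_of_isGeneric hv ha'gen ?_)
    rw [← hvO]
    exact congrArg Subtype.val hx
  let χ : ChartRing F (Sum.elim c d) →ₐ[L] L :=
    chartEval u fun f hf => mem_vanishingIdeal_iff.1 hf u huF
  have := hDs c
  have := isDomain_chartRing hFi ⟨u, huF⟩
  let : Algebra (ChartRing D c) (ChartRing F (Sum.elim c d)) := (chartProj c d hFD).toAlgebra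
  have : IsScalarTower L (ChartRing D c) (ChartRing F (Sum.elim c d)) :=
    .of_algebraMap_eq fun l => ((chartProj c d hFD).commutes l).symm
  have : FaithfulSMul (ChartRing D c) (ChartRing F (Sum.elim c d)) :=
    (faithfulSMul_iff_algebraMap_injective _ _).2 (chartProj_injective hFD hFi
      (fun y hy => by
        rw [← hF.image_eq] at hy
        exact hy) ⟨u, huF⟩)
  obtain ⟨β, hβα, hβχ⟩ := exists_algHom_lift_of_smooth (K := KOmega L) ρ
    (fun x => hS.isUnit_of_residue_ne_zero omegaSpec_algebraMap) χ
    (finite_algHom_chartProj hFD hF.isZariskiClosed hF.finite_fibre χ) α hα (fun x => by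
      obtain ⟨f, rfl⟩ := Ideal.Quotient.mk_surjective x
      have h1 : (ρ.comp α).comp (Ideal.Quotient.mkₐ L _) =
          (χ.comp (chartProj c d hFD)).comp (Ideal.Quotient.mkₐ L _) := by
        refine algHom_ext fun p => ?_
        change ρ (α (Ideal.Quotient.mk _ (X p))) =
          χ (chartProj c d hFD (Ideal.Quotient.mk _ (X p)))
        rw [chartProj_mk, rename_X]
        change ρ (aeval vO (X p)) = aeval u (X _)
        rw [aeval_X, aeval_X]
        exact (hS.residue_eq_iff omegaSpec_algebraMap).2 (hvu p)
      exact DFunLike.congr_fun h1 f)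
  let w : (Fin m ⊕ Fin k) × Fin (n + 1) → KOmega L := chartCoord (O.val.comp β)
  have hw : ∀ i, w (i, Sum.elim c d i) = 1 := chartCoord_eq_one (O.val.comp β)
  have hwu : ∀ p, OmegaSpec (w p) (u p) := fun p => by
    have h1 : ρ (β (Ideal.Quotient.mk _ (X p))) = u p := by
      rw [hβχ]
      exact aeval_X u p
    exact (hS.residue_eq_iff omegaSpec_algebraMap).1 h1
  have hwv : ∀ i j, w (Sum.inl i, j) = v (i, j) := fun i j => by
    have h1 := hβα (Ideal.Quotient.mk _ (X (i, j)))
    have h2 : algebraMap (ChartRing D c) (ChartRing F (Sum.elim c d))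
        (Ideal.Quotient.mk _ (X (i, j))) = Ideal.Quotient.mk _ (X (Sum.inl i, j)) :=
      (chartProj_mk hFD _).trans (by rw [rename_X]; rfl)
    have h3 : α (Ideal.Quotient.mk _ (X (i, j))) = vO (i, j) := aeval_X vO (i, j)
    rw [h2, h3] at h1
    exact congrArg Subtype.val h1
  let b' : Fin k → PSpace (KOmega L) n :=
    pointOf w (coord_ne_zero_of_eq_one hw) ∘ Sum.inr
  have hpt : Sum.elim (pointOf v (coord_ne_zero_of_eq_one hv)) b' =
      pointOf w (coord_ne_zero_of_eq_one hw) := by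
    funext i
    rcases i with i | j
    · simp only [Sum.elim_inl, pointOf, hwv]
    · rfl
  have hmem : Sum.elim (pointOf v (coord_ne_zero_of_eq_one hv)) b' ∈ points (KOmega L) F := by
    rw [hpt]
    exact pointOf_mem_points _ fun f hf => aeval_chartCoord_eq_zero (O.val.comp β) hf
  refine ⟨b', ⟨fun f hf hfV => ?_, fun j => ?_⟩, hmem⟩
  · have h1 := hmem _ (hf.rename (φ := Sum.inr)) fun y hy => by
      rw [VanishesAt, aeval_rename]
      exact hfV (y ∘ Sum.inr) (hF.subset_prod y hy).2
    rw [VanishesAt, aeval_rename] at h1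
    exact h1
  · rw [show b j = pointOf u (coord_ne_zero_of_eq_one hu) (Sum.inr j) from
      (congrFun hua (Sum.inr j)).symm]
    exact specialisation_mk _ _ fun l => hwu (Sum.inr j, l)
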